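/- **Setting.** Let $d\ge 1$ be an integer, $\beta\ge2$, $L,R>0$, $L_\beta\ge0$, $\tilde R\ge 0$, and let $K:[-1,1]\to\mathbb R$ be a square-integrable smoothing kernel of order $\beta$, i.e. $\int K=0$, $\int rK(r)\,dr=1$, $\int|r|^\beta|K(r)|\,dr<\infty$ and, if $\beta>2$, $\int r^jK(r)\,dr=0$ for $2\le j\le\lfloor\beta\rfloor$. Put $\kappa=\int K^2$, $\kappa_\beta=\int|u|^\beta|K(u)|\,du$ and $b_h=\kappa_\beta L_\beta h^{\beta-1}$. Consider the convergence bound of accelerated zeroth-order SGD under Tsybakov noise, $$\mathcal E(N,B,\delta,h)=\frac{LR^2}{N^2}\max\Big\{1,\Big(\frac{\kappa d}{B}\Big)^2\Big\}+N\min\Big\{\frac B\kappa,\frac{\kappa d^2}{B}\Big\}\Big(\frac{Lh^2}{d}+\frac{\delta^2}{Lh^2}\Big)+\tilde R\,b_h+\frac{N b_h^2}{L},$$ which holds up to a hidden constant $k\ge1$, and assume $\tilde R\le MR$ with $M\ge0$. A design is a triple $(N,B,\delta)$ of positive reals ($N$ iterations, batch size $B$, fidelity $\delta$; continuous relaxation).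 Its wall-clock time is $T=BN\delta^{-\gamma}$, $\gamma>0$, and $Q=BN$. It is feasible for accuracy $\varepsilon>0$, smoothing radius $h>0$ and cap $\Delta\in(0,\infty]$ if $\delta\le\Delta$ and $k\,\mathcal E(N,B,\delta,h)\le\varepsilon$. Let $$S(N,B,h)=N\min\Big\{\frac B\kappa,\frac{\kappa d^2}{B}\Big\}\frac{Lh^2}{d}+R\,b_h+\frac{N b_h^2}{L},\qquad G(\gamma)=\frac{(2\gamma)^{1/2}(2+\gamma)^{1/4}}{(2+3\gamma)^{3/4}}.$$ **Claim.** There is $c_0>0$ depending only on $k,M$ such that the following holds, where $\asymp$ has constants depending only on $k,M$, and $\asymp_\gamma,\lesssim_\gamma$ have constants depending only on $k,M,\gamma$. 1. (Small batches.) Let $0<B\le4\kappa d$ be fixed and put $Q_0=\kappa dR\sqrt L\,\varepsilon^{-1/2}\big(\frac{2+3\gamma}{2+\gamma}\big)^{1/2}$ and $\delta_0=hL^{1/4}(dR)^{-1/2}\varepsilon^{3/4}G(\gamma)$. If $\delta_0\le\Delta$ and $h$ is admissible, i.e. $S(Q_0/B,B,h)\le c_0\varepsilon$, then an optimal (least wall-clock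 time) feasible design with batch size $B$ exists, and every such design satisfies $$Q^*\asymp Q_0,\qquad \delta^*\asymp\delta_0,\qquad T^*\asymp_\gamma \kappa d^{\frac{2+\gamma}2}R^{\frac{2+\gamma}2}L^{\frac{2-\gamma}4}\varepsilon^{-\frac{2+3\gamma}4}h^{-\gamma}.$$ If moreover $\gamma\le2$, then $T^*\lesssim_\gamma T(D')$ for every feasible design $D'$ with batch size larger than $4\kappa d$: overbatching is not beneficial at leading order. 2. (Large batches.) Let $B>4\kappa d$ be fixed and put $N_0=R\sqrt L\,\varepsilon^{-1/2}\big(\frac{2+3\gamma}{2+\gamma}\big)^{1/2}$. If the fidelity is interior, i.e. $B^{1/2}hL^{1/4}(\kappa d^2R)^{-1/2}\varepsilon^{3/4}G(\gamma)\le\Delta$, and $S(N_0,B,h)\le c_0\varepsilon$, then an optimal feasible design with batch size $B$ exists, and every such design satisfies $$(\delta^*)^2\asymp_\gamma\frac{\varepsilon BLh^2}{N^*\kappa d^2},\qquad T^*\asymp_\gamma B^{1-\gamma/2}\,\kappa^{\gamma/2}d^\gamma R^{\frac{2+\gamma}2}L^{\frac{2-\gamma}4}\varepsilon^{-\frac{2+3\gamma}4}h^{-\gamma}.$$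 In particular $T^*\propto B^{1-\gamma/2}$ in order, and $\gamma=2$ is the batching threshold. 3. (Overbatching.) Let $\gamma>2$, $\Delta=1$, $N_1=RL^{1/2}\varepsilon^{-1/2}$ and $B_1=\kappa d^2RL^{-1/2}\varepsilon^{-3/2}h^{-2}$. If $B_1>4\kappa d$ and $S(N_1,B_1,h)\le c_0\varepsilon$, then an optimal design among all feasible $(N,B,\delta)$ with $B>4\kappa d$ exists, and every such design satisfies $$\delta^*=1,\qquad N^*\asymp N_1,\qquad B^*\asymp B_1,\qquad T^*\asymp\kappa d^2R^2\varepsilon^{-2}h^{-2}.$$ Moreover $T^*\lesssim_\gamma\big(hL^{1/4}(dR)^{-1/2}\varepsilon^{3/4}\big)^{\gamma-2}\,T(D')$ for every feasible design $D'$ with batch size at most $4\kappa d$. -/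

import Mathlib

open MeasureTheory

noncomputable section

/-- A smoothing kernel of order `β` on `[-1, 1]`. Square integrability makes the constant
`κ = ∫ |K|²` finite. -/
structure IsSmoothingKernel (β : ℝ) (k : ℝ → ℝ) : Prop where
  sq_integrable : MemLp k 2 (volume.restrict (Set.Icc (-1 : ℝ) 1))
  moment_zero : ∫ r in (-1 : ℝ)..1, k r = 0
  moment_one : ∫ r in (-1 : ℝ)..1, r * k r = 1
  moment_beta : IntervalIntegrable (fun r : ℝ => |r| ^ β * |k r|) volume (-1) 1
  moment_higher : 2 < β → ∀ j : ℕ, 2 ≤ j → j ≤ ⌊β⌋₊ → ∫ r in (-1 : ℝ)..1, r ^ j * k r = 0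

/-- The data entering the convergence bound of accelerated zeroth-order SGD: dimension `d`,
smoothness order `β`, smoothing kernel `ker`, smoothness constant `L`, Hölder constant `Lβ`,
initial radius `R` and trajectory radius `Rt` (written `R̃`). -/
structure AccSetting where
  d : ℕ
  β : ℝ
  ker : ℝ → ℝ
  L : ℝ
  Lβ : ℝ
  R : ℝ
  Rt : ℝ

namespace AccSetting

/-- Standing assumptions; `R̃ ≤ M R` is the assumption `R̃ = O(R)` with its constant. -/
structure Valid (P : AccSetting) (M : ℝ) : Prop where
  one_le_d : 1 ≤ P.d
  two_le_β : 2 ≤ P.β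
  kernel : IsSmoothingKernel P.β P.ker
  L_pos : 0 < P.L
  Lβ_nonneg : 0 ≤ P.Lβ
  R_pos : 0 < P.R
  Rt_nonneg : 0 ≤ P.Rt
  Rt_le : P.Rt ≤ M * P.R

/-- `κ = ∫ |K(u)|² du`. -/
def kappa (P : AccSetting) : ℝ := ∫ u in (-1 : ℝ)..1, |P.ker u| ^ 2

/-- `κ_β = ∫ |u|^β |K(u)| du`. -/
def kappaβ (P : AccSetting) : ℝ := ∫ u in (-1 : ℝ)..1, |u| ^ P.β * |P.ker u|

/-- The bias level `κ_β L_β h^(β-1)`. -/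
def bias (P : AccSetting) (h : ℝ) : ℝ := P.kappaβ * P.Lβ * h ^ (P.β - 1)

/-- The right-hand side of the convergence bound for accelerated zeroth-order SGD with the batched
two-point kernel estimator under Tsybakov noise. -/
def errorBound (P : AccSetting) (N B δ h : ℝ) : ℝ :=
  P.L * P.R ^ 2 / N ^ 2 * max 1 ((P.kappa * P.d / B) ^ 2)
    + N * min (B / P.kappa) (P.kappa * (P.d : ℝ) ^ 2 / B)
        * (P.L * h ^ 2 / P.d + δ ^ 2 / (P.L * h ^ 2))
    + P.Rt * P.bias h
    + N * P.bias h ^ 2 / P.L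

/-- The smoothing remainder: the part of the bound that involves neither `δ` nor the
deterministic convergence rate, with `R̃` replaced by `R`. -/
def smoothingRemainder (P : AccSetting) (N B h : ℝ) : ℝ :=
  N * min (B / P.kappa) (P.kappa * (P.d : ℝ) ^ 2 / B) * (P.L * h ^ 2 / P.d)
    + P.R * P.bias h
    + N * P.bias h ^ 2 / P.L

end AccSetting

/-- A design: number of iterations `N`, batch size `B` and fidelity `δ`. As in the continuous
relaxation of the design problem, `N` and `B` range over the positive reals. -/
structure Design where
  N : ℝ
  B : ℝ
  δ : ℝ

namespace Design

/-- Total number of oracle queries `Q = B N`. -/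
def Q (D : Design) : ℝ := D.B * D.N

/-- Wall-clock time `T = B N δ^(-γ)`. -/
def wallClock (γ : ℝ) (D : Design) : ℝ := D.B * D.N * D.δ ^ (-γ)

end Design

/-- Designs that are certified to reach accuracy `ε` with smoothing radius `h`: `K` is the
absolute constant hidden in the convergence bound, and `Δ` is the coarsest available fidelity
(`Δ = ⊤` when the fidelity is unrestricted). -/
def feasibleDesigns (K : ℝ) (P : AccSetting) (ε h : ℝ) (Δ : EReal) : Set Design :=
  {D | 0 < D.N ∧ 0 < D.B ∧ 0 < D.δ ∧ (D.δ : EReal) ≤ Δ ∧ K * P.errorBound D.N D.B D.δ h ≤ ε}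

/-- `D` has the smallest wall-clock time among the designs in `s`. -/
def IsOptimalDesign (γ : ℝ) (s : Set Design) (D : Design) : Prop :=
  D ∈ s ∧ ∀ D' ∈ s, D.wallClock γ ≤ D'.wallClock γ

/-- `x ≍ y` with constants `a` and `b`. -/
def SameOrder (a b x y : ℝ) : Prop := a * y ≤ x ∧ x ≤ b * y

/-- `G(γ) = (2γ)^(1/2) (2+γ)^(1/4) / (2+3γ)^(3/4)`. -/
def fidelityFactor (γ : ℝ) : ℝ :=
  (2 * γ) ^ (1 / 2 : ℝ) * (2 + γ) ^ (1 / 4 : ℝ) / (2 + 3 * γ) ^ (3 / 4 : ℝ)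

namespace AccSetting

/-- `κ d R √L ε^(-1/2) ((2+3γ)/(2+γ))^(1/2)`. -/
def smallBatchQ (P : AccSetting) (γ ε : ℝ) : ℝ :=
  P.kappa * P.d * P.R * √P.L * ε ^ (-1 / 2 : ℝ) * ((2 + 3 * γ) / (2 + γ)) ^ (1 / 2 : ℝ)

/-- `h L^(1/4) (d R)^(-1/2) ε^(3/4)`. -/
def baseFidelity (P : AccSetting) (ε h : ℝ) : ℝ :=
  h * P.L ^ (1 / 4 : ℝ) * (P.d * P.R) ^ (-1 / 2 : ℝ) * ε ^ (3 / 4 : ℝ)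

/-- `h L^(1/4) (d R)^(-1/2) ε^(3/4) G(γ)`. -/
def smallBatchFidelity (P : AccSetting) (γ ε h : ℝ) : ℝ :=
  P.baseFidelity ε h * fidelityFactor γ

/-- `κ d^((2+γ)/2) R^((2+γ)/2) L^((2-γ)/4) ε^(-(2+3γ)/4) h^(-γ)`. -/
def smallBatchTime (P : AccSetting) (γ ε h : ℝ) : ℝ :=
  P.kappa * (P.d : ℝ) ^ ((2 + γ) / 2) * P.R ^ ((2 + γ) / 2) * P.L ^ ((2 - γ) / 4)
    * ε ^ (-(2 + 3 * γ) / 4) * h ^ (-γ)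

/-- `R √L ε^(-1/2) ((2+3γ)/(2+γ))^(1/2)`. -/
def largeBatchN (P : AccSetting) (γ ε : ℝ) : ℝ :=
  P.R * √P.L * ε ^ (-1 / 2 : ℝ) * ((2 + 3 * γ) / (2 + γ)) ^ (1 / 2 : ℝ)

/-- `B^(1/2) h L^(1/4) (κ d² R)^(-1/2) ε^(3/4) G(γ)`. -/
def largeBatchFidelity (P : AccSetting) (γ ε h B : ℝ) : ℝ :=
  B ^ (1 / 2 : ℝ) * h * P.L ^ (1 / 4 : ℝ) * (P.kappa * (P.d : ℝ) ^ 2 * P.R) ^ (-1 / 2 : ℝ)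
    * ε ^ (3 / 4 : ℝ) * fidelityFactor γ

/-- The factor `κ^(γ/2) d^γ R^((2+γ)/2) L^((2-γ)/4) ε^(-(2+3γ)/4) h^(-γ)`, free of `B`. -/
def largeBatchTimeFactor (P : AccSetting) (γ ε h : ℝ) : ℝ :=
  P.kappa ^ (γ / 2) * (P.d : ℝ) ^ γ * P.R ^ ((2 + γ) / 2) * P.L ^ ((2 - γ) / 4)
    * ε ^ (-(2 + 3 * γ) / 4) * h ^ (-γ)

/-- `R L^(1/2) ε^(-1/2)`. -/
def overbatchN (P : AccSetting) (ε : ℝ) : ℝ := P.R * √P.L * ε ^ (-1 / 2 : ℝ)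

/-- `κ d² R L^(-1/2) ε^(-3/2) h^(-2)`. -/
def overbatchB (P : AccSetting) (ε h : ℝ) : ℝ :=
  P.kappa * (P.d : ℝ) ^ 2 * P.R * P.L ^ (-1 / 2 : ℝ) * ε ^ (-3 / 2 : ℝ) * h ^ (-2 : ℝ)

/-- `κ d² R² ε^(-2) h^(-2)`. -/
def overbatchTime (P : AccSetting) (ε h : ℝ) : ℝ :=
  P.kappa * (P.d : ℝ) ^ 2 * P.R ^ 2 * ε ^ (-2 : ℝ) * h ^ (-2 : ℝ)

end AccSetting

end

/-!
Every scale in the problem depends on the batch size `B` only through the load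
`w = max 1 (B / (κ d))`, because `max 1 ((κ d / B)²) = (w κ d / B)²` and
`min (B / κ) (κ d² / B) = B / (κ w²)`. Measure `N` in units of `iterUnit`, which is `κ d R √L ε^(-1/2) w / B`,
and `δ` in units of `fidelityUnit`, which is `h L^(1/4) (d R)^(-1/2) ε^(3/4) √w`. By
`AccSetting.errorBound_eq` the error bound becomes `ε (1/u² + u (σ + v²) + ρ)`, where `σ` and `ρ` stem
from smoothing, and the time becomes `timeUnit · u v^(-γ)`, where `timeUnit` is
`smallBatchTime · w^(1 - γ/2)`. The sign of `1 - γ/2` decides whether large batches pay.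

The fixed-batch problem is thus the minimization of `u v^(-γ)` subject to
`K (1/u² + u (σ + v²) + ρ) ≤ 1` and a cap on `v`, with `σ, ρ` small.

* Feasibility alone forces `u ≥ 1` and `v ≤ 1` (`reducedFeasible.bounds`), so `timeUnit` bounds the time
  of every feasible design from below (`feasibleDesigns.bounds`). This gives all comparisons between
  regimes.
* An optimal point has `u ≤ 8 K`, since longer runs lose to one with `2 K` iterations and the same
  fidelity (`IsReducedOptimal.fst_le`).
* Along the curve `(u e^(γ t), v e^t)` the time is constant, so the error is minimal at an optimal
  point. The derivative of the error there (`IsReducedOptimal.first_variation`) yields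
  `(2 + γ) u v² = γ (2/u² - σ u)` when the cap is inactive and the inequality `≤` in general. Hence `v²` is
  of order `γ / (2 + γ)`, that is `G(γ)²`, with constants independent of `γ`
  (`IsReducedOptimal.snd_bounds`).

For joint optimization with `γ > 2`, the replacement of `(B, δ)` by `(B / δ², 1)` does not increase the
error and multiplies the time by `δ^(γ-2)`, so `δ = 1`. At `δ = 1` feasibility forces `N ≥ N₁` and `B ≥ B₁`
(`feasibleDesigns.overbatch_le`), while the design `(2 K N₁, 8 K² B₁, 1)` is feasible. This pins `N`, `B` and
the time up to constants, and it makes the problem coercive even though `B > 4 κ d` is an open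
condition.
-/

noncomputable section

/-! ### The dimensionless problem -/

/-- Feasible set of the dimensionless design problem: `u` is the number of iterations and `v` the
fidelity, both in their natural units; `σ` and `ρ` are the smoothing terms, and `I` is the set of
admissible fidelities. -/
def reducedFeasible (K σ ρ : ℝ) (I : Set ℝ) : Set (ℝ × ℝ) :=
  {p | 0 < p.1 ∧ 0 < p.2 ∧ p.2 ∈ I ∧ K * (1 / p.1 ^ 2 + p.1 * (σ + p.2 ^ 2) + ρ) ≤ 1}

/-- Wall-clock time in the dimensionless problem. -/
def reducedTime (γ : ℝ) (p : ℝ × ℝ) : ℝ := p.1 * p.2 ^ (-γ)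

/-- Minimizers of the dimensionless problem. -/
def IsReducedOptimal (K σ ρ γ : ℝ) (I : Set ℝ) (p : ℝ × ℝ) : Prop :=
  p ∈ reducedFeasible K σ ρ I ∧ ∀ q ∈ reducedFeasible K σ ρ I, reducedTime γ p ≤ reducedTime γ q

section Reduced

variable {K σ ρ γ : ℝ} {I : Set ℝ} {p : ℝ × ℝ}

theorem reducedFeasible.bounds (hK : 1 ≤ K) (hσ : 0 ≤ σ) (hρ : 0 ≤ ρ)
    (hp : p ∈ reducedFeasible K σ ρ I) :
    1 ≤ p.1 ∧ p.1 * p.2 ^ 2 ≤ 1 / K ∧ p.2 ≤ 1 := by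
  obtain ⟨hu, hv, -, h⟩ := hp
  have hK0 : 0 < K := by linarith
  have h1 : 0 < 1 / p.1 ^ 2 := by positivity
  have h2 : 0 ≤ p.1 * σ := by positivity
  have h3 : 0 < p.1 * p.2 ^ 2 := by positivity
  have hsum : 1 / p.1 ^ 2 + p.1 * (σ + p.2 ^ 2) + ρ ≤ 1 / K := by
    rw [le_div_iff₀ hK0]; linarith
  have hK1 : 1 / K ≤ 1 := by rw [div_le_one hK0]; exact hK
  have hu1 : 1 ≤ p.1 := by
    have : 1 / p.1 ^ 2 ≤ 1 := by nlinarith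
    rw [div_le_one (by positivity)] at this
    exact (one_le_sq_iff₀ hu.le).1 this
  have huv : p.1 * p.2 ^ 2 ≤ 1 / K := by nlinarith
  refine ⟨hu1, huv, ?_⟩
  exact (sq_le_one_iff₀ hv.le).1 (by nlinarith)

/-- Any fidelity `v` with `v² ≤ 1 / (8 K²)` is affordable with `2 K` iterations. -/
theorem mem_reducedFeasible_two_mul (hK : 1 ≤ K) (hσ' : σ ≤ 1 / (8 * K) ^ 3)
    (hρ' : ρ ≤ 1 / (8 * K) ^ 3) {v : ℝ} (hv : 0 < v) (hvI : v ∈ I) (hv2 : v ^ 2 ≤ 1 / (8 * K ^ 2)) :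
    (2 * K, v) ∈ reducedFeasible K σ ρ I := by
  have hK0 : 0 < K := by linarith
  refine ⟨by positivity, hv, hvI, ?_⟩
  have e1 : K * (1 / (2 * K) ^ 2) ≤ 1 / 4 := by
    rw [show K * (1 / (2 * K) ^ 2) = 1 / (4 * K) by field_simp; ring]
    gcongr; linarith
  have e2 : K * (2 * K * σ) ≤ 1 / 256 := by
    calc K * (2 * K * σ) ≤ K * (2 * K * (1 / (8 * K) ^ 3)) := by gcongr
      _ = 1 / (256 * K) := by field_simp; ring
      _ ≤ 1 / 256 := by gcongr; linarith
  have e3 : K * (2 * K * v ^ 2) ≤ 1 / 4 := by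
    calc K * (2 * K * v ^ 2) ≤ K * (2 * K * (1 / (8 * K ^ 2))) := by gcongr
      _ = 1 / 4 := by field_simp; ring
  have e4 : K * ρ ≤ 1 / 256 := by
    calc K * ρ ≤ K * (1 / (8 * K) ^ 3) := by gcongr
      _ = 1 / (512 * K ^ 2) := by field_simp; ring
      _ ≤ 1 / 256 := by gcongr; nlinarith
  dsimp only
  linarith

/-- A function attains its minimum over `s` if one of its sublevel sets in `s` lies in some `C` such
that `s ∩ C` is compact and the function is continuous on `s ∩ C`. -/
theorem exists_forall_le_of_sublevel {X : Type*} [TopologicalSpace X] {s C : Set X} {f : X → ℝ}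
    {x₀ : X} (hx₀ : x₀ ∈ s) (hC : IsCompact (s ∩ C)) (hf : ContinuousOn f (s ∩ C))
    (hsub : ∀ x ∈ s, f x ≤ f x₀ → x ∈ C) : ∃ x ∈ s, ∀ y ∈ s, f x ≤ f y := by
  obtain ⟨x, hx, hmin⟩ := hC.exists_isMinOn ⟨x₀, hx₀, hsub x₀ hx₀ le_rfl⟩ hf
  refine ⟨x, hx.1, fun y hy => ?_⟩
  rcases le_total (f y) (f x₀) with h | h
  · exact hmin ⟨hy, hsub y hy h⟩
  · exact (hmin ⟨hx₀, hsub x₀ hx₀ le_rfl⟩ : f x ≤ f x₀).trans h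

theorem exists_isReducedOptimal (hK : 1 ≤ K) (hσ : 0 ≤ σ) (hρ : 0 ≤ ρ)
    (hσ' : σ ≤ 1 / (8 * K) ^ 3) (hρ' : ρ ≤ 1 / (8 * K) ^ 3) (hγ : 0 < γ) (hI : IsLowerSet I)
    (hIc : IsClosed I) {v₀ : ℝ} (hv₀ : 0 < v₀) (hv₀I : v₀ ∈ I) :
    ∃ p, IsReducedOptimal K σ ρ γ I p := by
  have hK0 : 0 < K := by linarith
  set v₁ := min v₀ (1 / (3 * K)) with hv₁
  have hv₁0 : 0 < v₁ := lt_min hv₀ (by positivity)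
  have hp₁ : (2 * K, v₁) ∈ reducedFeasible K σ ρ I := by
    refine mem_reducedFeasible_two_mul hK hσ' hρ' hv₁0 (hI (min_le_left _ _) hv₀I) ?_
    calc v₁ ^ 2 ≤ (1 / (3 * K)) ^ 2 := by gcongr; exact min_le_right _ _
      _ = 1 / (9 * K ^ 2) := by field_simp; ring
      _ ≤ 1 / (8 * K ^ 2) := by gcongr; norm_num
  set T := reducedTime γ (2 * K, v₁) with hT
  have hT0 : 0 < T := by
    simp only [hT, reducedTime]; positivity
  -- `u ≥ 1` and `v ≤ 1` bound `v` below and `u` above on the sublevel set of level `T`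
  set m := T ^ (-γ⁻¹) with hm
  have hm0 : 0 < m := by positivity
  have hcompact : IsCompact (reducedFeasible K σ ρ I ∩ Set.Icc (1 : ℝ) T ×ˢ Set.Icc m 1) := by
    have heq : reducedFeasible K σ ρ I ∩ Set.Icc (1 : ℝ) T ×ˢ Set.Icc m 1 =
        (Set.Icc (1 : ℝ) T ×ˢ Set.Icc m 1 ∩
          (fun q : ℝ × ℝ => K * (1 / q.1 ^ 2 + q.1 * (σ + q.2 ^ 2) + ρ)) ⁻¹' Set.Iic 1)
          ∩ Prod.snd ⁻¹' I := by
      ext q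
      simp only [reducedFeasible, Set.mem_inter_iff, Set.mem_ofPred_eq, Set.mem_prod, Set.mem_Icc,
        Set.mem_preimage, Set.mem_Iic]
      constructor
      · tauto
      · rintro ⟨⟨⟨⟨h1, h2⟩, h3, h4⟩, h5⟩, h6⟩
        exact ⟨⟨by linarith, by linarith, h6, h5⟩, ⟨h1, h2⟩, h3, h4⟩
    rw [heq]
    refine (IsCompact.of_isClosed_subset (isCompact_Icc.prod isCompact_Icc) ?_
      Set.inter_subset_left).inter_right (hIc.preimage continuous_snd)
    refine ContinuousOn.preimage_isClosed_of_isClosed ?_ (isClosed_Icc.prod isClosed_Icc)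
      isClosed_Iic
    refine continuousOn_const.mul (((continuousOn_const.div (by fun_prop) ?_).add
      (by fun_prop)).add continuousOn_const)
    rintro q ⟨hq, -⟩
    have : 0 < q.1 := by linarith [hq.1]
    positivity
  refine exists_forall_le_of_sublevel hp₁ hcompact ?_ ?_
  · refine continuousOn_fst.mul (continuousOn_snd.rpow_const ?_)
    rintro q ⟨-, -, hq⟩
    exact Or.inl (by linarith [hq.1])
  · intro q hq hqT
    obtain ⟨h1, -, h3⟩ := reducedFeasible.bounds hK hσ hρ hq
    have hv := hq.2.1
    have hvγ : 1 ≤ q.2 ^ (-γ) := Real.one_le_rpow_of_pos_of_le_one_of_nonpos hv h3 (by linarith)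
    change q.1 * q.2 ^ (-γ) ≤ T at hqT
    refine ⟨⟨h1, by nlinarith⟩, ?_, h3⟩
    have hle : q.2 ^ (-γ) ≤ T := by nlinarith
    calc m ≤ (q.2 ^ (-γ)) ^ (-γ⁻¹) := by
          rw [hm]
          exact Real.rpow_le_rpow_of_nonpos (by positivity) hle (by simpa using hγ.le)
      _ = q.2 := by
          rw [← Real.rpow_mul hv.le, neg_mul_neg, mul_inv_cancel₀ hγ.ne', Real.rpow_one]

/-- Long runs are wasteful: with more than `8 K` iterations, the same fidelity is already affordable
with `2 K` iterations. -/
theorem IsReducedOptimal.fst_le (hK : 1 ≤ K) (hσ : 0 ≤ σ) (hρ : 0 ≤ ρ)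
    (hσ' : σ ≤ 1 / (8 * K) ^ 3) (hρ' : ρ ≤ 1 / (8 * K) ^ 3)
    (hp : IsReducedOptimal K σ ρ γ I p) : p.1 ≤ 8 * K := by
  by_contra! hlt
  have hK0 : 0 < K := by linarith
  obtain ⟨-, h2, -⟩ := reducedFeasible.bounds hK hσ hρ hp.1
  obtain ⟨hu, hv, hvI, -⟩ := hp.1
  have hv2 : p.2 ^ 2 ≤ 1 / (8 * K ^ 2) := by
    rw [le_div_iff₀ hK0] at h2
    rw [le_div_iff₀ (by positivity)]
    nlinarith [mul_le_mul_of_nonneg_right hlt.le (by positivity : 0 ≤ p.2 ^ 2 * K)]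
  have := hp.2 _ (mem_reducedFeasible_two_mul hK hσ' hρ' hv hvI hv2)
  have hvγ : 0 < p.2 ^ (-γ) := by positivity
  have := le_of_mul_le_mul_right this hvγ
  dsimp only at this
  linarith

/-- A point that ties with an optimal one has no slack in the error constraint: slack could be
spent on fewer iterations. -/
theorem IsReducedOptimal.one_le_of_reducedTime_eq (hp : IsReducedOptimal K σ ρ γ I p) {q : ℝ × ℝ}
    (hu : 0 < q.1) (hv : 0 < q.2) (hvI : q.2 ∈ I) (hT : reducedTime γ q = reducedTime γ p) :
    1 ≤ K * (1 / q.1 ^ 2 + q.1 * (σ + q.2 ^ 2) + ρ) := by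
  by_contra! hlt
  have hcont : ContinuousAt (fun u : ℝ => K * (1 / u ^ 2 + u * (σ + q.2 ^ 2) + ρ)) q.1 := by
    refine continuousAt_const.mul (((continuousAt_const.div (by fun_prop) ?_).add
      (by fun_prop)).add continuousAt_const)
    positivity
  have h1 : ∀ᶠ u in nhdsWithin q.1 (Set.Iio q.1),
      K * (1 / u ^ 2 + u * (σ + q.2 ^ 2) + ρ) < 1 ∧ 0 < u ∧ u < q.1 :=
    ((hcont.eventually (gt_mem_nhds hlt)).filter_mono nhdsWithin_le_nhds).and
      (((lt_mem_nhds hu).filter_mono nhdsWithin_le_nhds).and self_mem_nhdsWithin)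
  obtain ⟨u, hu1, hu2, hu3⟩ := h1.exists
  have := hp.2 (u, q.2) ⟨hu2, hv, hvI, hu1.le⟩
  rw [← hT] at this
  have := le_of_mul_le_mul_right this (by positivity : 0 < q.2 ^ (-γ))
  dsimp only at this
  linarith

theorem HasDerivAt.nonneg_of_forall_le {f : ℝ → ℝ} {f' η : ℝ} (hf : HasDerivAt f f' 0)
    (hη : 0 < η) (h : ∀ t, 0 < t → t ≤ η → f 0 ≤ f t) : 0 ≤ f' := by
  have ht := (hasDerivWithinAt_iff_tendsto_slope' (by simp)).1
    (hf.hasDerivWithinAt (s := Set.Ioi 0))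
  refine ge_of_tendsto ht ?_
  filter_upwards [Ioc_mem_nhdsGT hη] with t ht
  rw [slope_def_field]
  exact div_nonneg (sub_nonneg.2 (h t ht.1 ht.2)) (by linarith [ht.1])

/-- First variation of the error along the curve `t ↦ (u e^{γ c t}, v e^{c t})`, on which the time is
constant. -/
theorem IsReducedOptimal.first_variation (hK : 1 ≤ K) (hp : IsReducedOptimal K σ ρ γ I p)
    {c η : ℝ} (hη : 0 < η) (hcI : ∀ t, 0 < t → t ≤ η → p.2 * Real.exp (c * t) ∈ I) :
    0 ≤ c * (-(2 * γ) * (1 / p.1 ^ 2) + γ * (p.1 * σ) + (γ + 2) * (p.1 * p.2 ^ 2)) := by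
  obtain ⟨hu, hv, hvI, hle⟩ := hp.1
  have hK0 : 0 < K := by linarith
  set φ : ℝ → ℝ := fun t => 1 / p.1 ^ 2 * Real.exp (-(2 * γ) * c * t)
    + p.1 * σ * Real.exp (γ * c * t) + p.1 * p.2 ^ 2 * Real.exp ((γ + 2) * c * t) + ρ with hφ
  have hexp : ∀ k : ℝ, HasDerivAt (fun t => Real.exp (k * t)) k 0 := fun k => by
    simpa using ((hasDerivAt_id (0 : ℝ)).const_mul k).exp
  have hderiv : HasDerivAt φ (1 / p.1 ^ 2 * (-(2 * γ) * c) + p.1 * σ * (γ * c)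
      + p.1 * p.2 ^ 2 * ((γ + 2) * c)) 0 :=
    ((((hexp _).const_mul _).add ((hexp _).const_mul _)).add ((hexp _).const_mul _)).add_const _
  have key : 0 ≤ 1 / p.1 ^ 2 * (-(2 * γ) * c) + p.1 * σ * (γ * c)
      + p.1 * p.2 ^ 2 * ((γ + 2) * c) := by
    refine hderiv.nonneg_of_forall_le hη fun t ht0 htη => ?_
    have h0 : K * φ 0 ≤ 1 := by
      have : φ 0 = 1 / p.1 ^ 2 + p.1 * (σ + p.2 ^ 2) + ρ := by simp [hφ]; ring
      rw [this]; exact hle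
    have h1 : 1 ≤ K * φ t := by
      have := hp.one_le_of_reducedTime_eq (q := (p.1 * Real.exp (γ * (c * t)),
        p.2 * Real.exp (c * t))) (by positivity) (by positivity) (hcI t ht0 htη) (by
          simp only [reducedTime]
          rw [Real.mul_rpow hv.le (Real.exp_pos _).le, ← Real.exp_mul,
            show c * t * -γ = -(γ * (c * t)) by ring, Real.exp_neg]
          field_simp)
      convert this using 2
      simp only [hφ]
      rw [show -(2 * γ) * c * t = -(γ * (c * t) + γ * (c * t)) by ring,
        show γ * c * t = γ * (c * t) by ring,
        show (γ + 2) * c * t = γ * (c * t) + (c * t + c * t) by ring, Real.exp_neg,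
        Real.exp_add, Real.exp_add, Real.exp_add]
      field_simp
      ring
    exact le_of_mul_le_mul_left (h0.trans h1) hK0
  linarith

/-- Stationarity in the direction of decreasing fidelity, which the cap never obstructs. -/
theorem IsReducedOptimal.sq_le (hK : 1 ≤ K) (hσ : 0 ≤ σ) (hγ : 0 < γ) (hI : IsLowerSet I)
    (hρ : 0 ≤ ρ) (hp : IsReducedOptimal K σ ρ γ I p) :
    p.2 ^ 2 ≤ 2 * γ / (2 + γ) := by
  have h := hp.first_variation hK (c := -1) one_pos fun t ht _ => hI (mul_le_of_le_one_right
    hp.1.2.1.le (Real.exp_le_one_iff.2 (by linarith))) hp.1.2.2.1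
  obtain ⟨h1, -, -⟩ := reducedFeasible.bounds hK hσ hρ hp.1
  have hs : 0 ≤ γ * (p.1 * σ) := by positivity
  have h2 : 1 / p.1 ^ 2 ≤ 1 := by
    rw [div_le_one (by positivity)]; nlinarith
  have h3 : γ * (1 / p.1 ^ 2) ≤ γ := by nlinarith
  have h4 : (2 + γ) * p.2 ^ 2 ≤ (2 + γ) * (p.1 * p.2 ^ 2) := by
    have := mul_le_mul_of_nonneg_right h1 (sq_nonneg p.2)
    nlinarith
  rw [le_div_iff₀ (by linarith)]
  linarith

/-- Stationarity in the direction of increasing fidelity, available when the cap is not reached. -/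
theorem IsReducedOptimal.le_sq (hK : 1 ≤ K) (hσ : 0 ≤ σ) (hρ : 0 ≤ ρ)
    (hσ' : σ ≤ 1 / (8 * K) ^ 3) (hρ' : ρ ≤ 1 / (8 * K) ^ 3) (hγ : 0 < γ) (hI : IsLowerSet I)
    (hp : IsReducedOptimal K σ ρ γ I p) {v : ℝ} (hvI : v ∈ I) (hv : p.2 < v) :
    γ / (2 + γ) / (8 * K) ^ 3 ≤ p.2 ^ 2 := by
  have hK0 : 0 < K := by linarith
  have hp0 := hp.1.2.1
  have hη : 0 < Real.log (v / p.2) := Real.log_pos ((one_lt_div hp0).2 hv)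
  have h := hp.first_variation hK (c := 1) hη fun t _ ht => hI (by
    rw [one_mul]
    calc p.2 * Real.exp t ≤ p.2 * Real.exp (Real.log (v / p.2)) := by gcongr
      _ = v := by rw [Real.exp_log (by have := hp0.trans hv; positivity)]; field_simp) hvI
  have hu := hp.fst_le hK hσ hρ hσ' hρ'
  have hu0 := hp.1.1
  have h2 : 1 / (8 * K) ^ 2 ≤ 1 / p.1 ^ 2 := by gcongr
  have h3 : p.1 * σ ≤ 1 / (8 * K) ^ 2 := by
    calc p.1 * σ ≤ (8 * K) * (1 / (8 * K) ^ 3) := by gcongr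
      _ = 1 / (8 * K) ^ 2 := by field_simp
  have h4 : p.1 * p.2 ^ 2 ≤ 8 * K * p.2 ^ 2 := by gcongr
  have h5 : γ * (1 / (8 * K) ^ 2) ≤ (γ + 2) * (8 * K * p.2 ^ 2) := by
    nlinarith [mul_le_mul_of_nonneg_left h4 (by linarith : 0 ≤ γ + 2)]
  rw [div_div, div_le_iff₀ (by positivity)]
  rw [mul_one_div, div_le_iff₀ (by positivity)] at h5
  nlinarith

end Reduced

/-! ### The fidelity factor -/

theorem fidelityFactor_pos {γ : ℝ} (hγ : 0 < γ) : 0 < fidelityFactor γ := by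
  unfold fidelityFactor; positivity

theorem fidelityFactor_sq {γ : ℝ} (hγ : 0 < γ) :
    fidelityFactor γ ^ 2 = 2 * γ / (2 + γ) * ((2 + γ) / (2 + 3 * γ)) ^ (3 / 2 : ℝ) := by
  have h1 : 0 < 2 + γ := by linarith
  have h2 : 0 < 2 + 3 * γ := by linarith
  unfold fidelityFactor
  rw [div_pow, mul_pow, ← Real.rpow_natCast, ← Real.rpow_natCast, ← Real.rpow_natCast,
    ← Real.rpow_mul (by positivity), ← Real.rpow_mul (by positivity),
    ← Real.rpow_mul (by positivity), Real.div_rpow (by positivity) (by positivity)]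
  norm_num
  rw [show (3 / 2 : ℝ) = 1 + 1 / 2 by norm_num, Real.rpow_add h1, Real.rpow_one]
  field_simp

theorem fidelityFactor_sq_le {γ : ℝ} (hγ : 0 < γ) : fidelityFactor γ ^ 2 ≤ 2 * γ / (2 + γ) := by
  rw [fidelityFactor_sq hγ]
  refine mul_le_of_le_one_right (by positivity) (Real.rpow_le_one (by positivity) ?_ (by norm_num))
  rw [div_le_one (by positivity)]; linarith

theorem le_fidelityFactor_sq {γ : ℝ} (hγ : 0 < γ) :
    2 * γ / (2 + γ) ≤ 9 * fidelityFactor γ ^ 2 := by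
  rw [fidelityFactor_sq hγ]
  have h : (1 / 3 : ℝ) ≤ (2 + γ) / (2 + 3 * γ) := by
    rw [div_le_div_iff₀ (by norm_num) (by positivity)]; linarith
  have h' : (1 / 9 : ℝ) ≤ ((2 + γ) / (2 + 3 * γ)) ^ (3 / 2 : ℝ) := by
    calc (1 / 9 : ℝ) = (1 / 3) ^ (2 : ℝ) := by norm_num
      _ ≤ (1 / 3) ^ (3 / 2 : ℝ) :=
        Real.rpow_le_rpow_of_exponent_ge (by norm_num) (by norm_num) (by norm_num)
      _ ≤ _ := Real.rpow_le_rpow (by norm_num) h (by norm_num)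
  have : 0 < 2 * γ / (2 + γ) := by positivity
  nlinarith

/-- The optimal fidelity is of the order of `fidelityFactor γ`, with constants that do not depend on
`γ`. -/
theorem IsReducedOptimal.snd_bounds {K σ ρ γ : ℝ} {I : Set ℝ} {p : ℝ × ℝ} (hK : 1 ≤ K)
    (hσ : 0 ≤ σ) (hρ : 0 ≤ ρ) (hσ' : σ ≤ 1 / (8 * K) ^ 3) (hρ' : ρ ≤ 1 / (8 * K) ^ 3) (hγ : 0 < γ)
    (hI : IsLowerSet I) (hp : IsReducedOptimal K σ ρ γ I p) {v₀ : ℝ} (hv₀I : v₀ ∈ I)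
    (hv₀ : fidelityFactor γ / (8 * K) ^ 2 ≤ v₀) :
    fidelityFactor γ / (8 * K) ^ 2 ≤ p.2 ∧ p.2 ≤ 3 * fidelityFactor γ := by
  have hG := fidelityFactor_pos hγ
  have hp0 := hp.1.2.1
  constructor
  · rcases le_or_gt v₀ p.2 with h | h
    · exact hv₀.trans h
    · have h1 := hp.le_sq hK hσ hρ hσ' hρ' hγ hI hv₀I h
      have h2 := fidelityFactor_sq_le hγ
      refine le_of_sq_le_sq ?_ hp0.le
      calc (fidelityFactor γ / (8 * K) ^ 2) ^ 2 = fidelityFactor γ ^ 2 / (8 * K) ^ 4 := by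
            rw [div_pow]; ring
        _ ≤ (2 * γ / (2 + γ)) / (8 * K) ^ 4 := by gcongr
        _ = γ / (2 + γ) / (8 * K) ^ 3 * (2 / (8 * K)) := by field_simp
        _ ≤ γ / (2 + γ) / (8 * K) ^ 3 * 1 := by
            gcongr; rw [div_le_one (by positivity)]; linarith
        _ ≤ p.2 ^ 2 := by linarith
  · have h1 := hp.sq_le hK hσ hγ hI hρ
    have h2 := le_fidelityFactor_sq hγ
    nlinarith

/-! ### Reduction of the fixed-batch problem -/

namespace AccSetting

variable {P : AccSetting} {M K γ ε h B : ℝ} {Δ : EReal} {D : Design}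

/-- A kernel with `∫ |K|² = 0` would vanish almost everywhere, against `∫ r K(r) dr = 1`. -/
theorem Valid.kappa_pos (hP : P.Valid M) : 0 < P.kappa := by
  have hint : IntervalIntegrable (fun u => |P.ker u| ^ 2) volume (-1) 1 := by
    rw [intervalIntegrable_iff_integrableOn_Icc_of_le (by norm_num)]
    have := hP.kernel.sq_integrable.integrable_norm_rpow (by norm_num) (by norm_num)
    simpa [IntegrableOn] using this
  have hnn : ∀ u, 0 ≤ |P.ker u| ^ 2 := fun u => by positivity
  refine lt_of_le_of_ne (intervalIntegral.integral_nonneg (by norm_num) fun u _ => hnn u) ?_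
  intro h0
  have hae := (intervalIntegral.integral_eq_zero_iff_of_le_of_nonneg_ae (by norm_num)
    (Filter.Eventually.of_forall hnn) hint).1 h0.symm
  have h1 := hP.kernel.moment_one
  rw [intervalIntegral.integral_of_le (by norm_num), integral_eq_zero_of_ae] at h1
  · norm_num at h1
  · filter_upwards [hae] with u hu
    have : P.ker u = 0 := by simpa using hu
    simp [this]

theorem Valid.d_pos (hP : P.Valid M) : (0 : ℝ) < P.d := by
  exact_mod_cast (hP.one_le_d : 0 < P.d)

theorem bias_nonneg (hP : P.Valid M) (hh : 0 < h) : 0 ≤ P.bias h := by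
  have h1 : 0 ≤ P.kappaβ :=
    intervalIntegral.integral_nonneg (by norm_num) fun u _ => by positivity
  have := hP.Lβ_nonneg
  unfold bias
  positivity

/-- The load `w = max 1 (B / (κ d))` of a batch size: it is constant in the small-batch regime and
proportional to `B` beyond it, and all `B`-dependent scales are powers of it. -/
def batchLoad (P : AccSetting) (B : ℝ) : ℝ := max 1 (B / (P.kappa * P.d))

/-- The number of queries `κ d R √L ε^(-1/2)` of the small-batch regime. -/
def queryUnit (P : AccSetting) (ε : ℝ) : ℝ := P.kappa * P.d * P.overbatchN ε

/-- The natural unit of the number of iterations at batch size `B`: after that many iterations the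
deterministic part of the error bound equals `ε`. -/
def iterUnit (P : AccSetting) (ε B : ℝ) : ℝ := P.queryUnit ε * P.batchLoad B / B

/-- The natural unit of the fidelity at batch size `B`: after `iterUnit` iterations, the fidelity part
of the error bound equals `ε`. -/
def fidelityUnit (P : AccSetting) (ε h B : ℝ) : ℝ := P.baseFidelity ε h * √(P.batchLoad B)

/-- The natural unit of the wall-clock time. -/
def timeUnit (P : AccSetting) (γ ε h B : ℝ) : ℝ :=
  P.queryUnit ε * P.baseFidelity ε h ^ (-γ) * P.batchLoad B ^ (1 - γ / 2)

/-- The growth per iteration of the smoothing terms in the error bound. -/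
def smoothingRate (P : AccSetting) (h B : ℝ) : ℝ :=
  B / (P.kappa * P.batchLoad B ^ 2) * (P.L * h ^ 2 / P.d) + P.bias h ^ 2 / P.L

/-- Fidelities admitted by the cap, in natural units. -/
def cappedFidelities (P : AccSetting) (ε h B : ℝ) (Δ : EReal) : Set ℝ :=
  {v | ((P.fidelityUnit ε h B * v : ℝ) : EReal) ≤ Δ}

/-- The dimensionless form of a design. -/
def reduce (P : AccSetting) (ε h : ℝ) (D : Design) : ℝ × ℝ :=
  (D.N / P.iterUnit ε D.B, D.δ / P.fidelityUnit ε h D.B)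

theorem one_le_batchLoad : 1 ≤ P.batchLoad B := le_max_left _ _

theorem batchLoad_pos : 0 < P.batchLoad B := one_pos.trans_le one_le_batchLoad

theorem batchLoad_eq (hP : P.Valid M) (hB : P.kappa * P.d ≤ B) :
    P.batchLoad B = B / (P.kappa * P.d) := by
  have := hP.kappa_pos; have := hP.d_pos
  exact max_eq_right ((one_le_div (by positivity)).2 hB)

theorem batchLoad_le_four (hP : P.Valid M) (hB : B ≤ 4 * P.kappa * P.d) : P.batchLoad B ≤ 4 := by
  have := hP.kappa_pos; have := hP.d_pos
  refine max_le (by norm_num) ?_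
  rw [div_le_iff₀ (by positivity)]; linarith

theorem Valid.kappa_mul_d_lt (hP : P.Valid M) (hB : 4 * P.kappa * P.d < B) :
    P.kappa * P.d < B := by
  have := mul_pos hP.kappa_pos hP.d_pos; linarith

theorem overbatchN_pos (hP : P.Valid M) (hε : 0 < ε) : 0 < P.overbatchN ε := by
  have := hP.R_pos; have := hP.L_pos
  unfold overbatchN; positivity

theorem queryUnit_pos (hP : P.Valid M) (hε : 0 < ε) : 0 < P.queryUnit ε := by
  have := hP.kappa_pos; have := hP.d_pos; have := overbatchN_pos hP hε
  unfold queryUnit; positivity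

theorem baseFidelity_pos (hP : P.Valid M) (hε : 0 < ε) (hh : 0 < h) : 0 < P.baseFidelity ε h := by
  have := hP.d_pos; have := hP.R_pos; have := hP.L_pos
  unfold baseFidelity; positivity

theorem iterUnit_pos (hP : P.Valid M) (hε : 0 < ε) (hB : 0 < B) : 0 < P.iterUnit ε B := by
  have := queryUnit_pos hP hε; have := batchLoad_pos (P := P) (B := B)
  unfold iterUnit; positivity

theorem fidelityUnit_pos (hP : P.Valid M) (hε : 0 < ε) (hh : 0 < h) :
    0 < P.fidelityUnit ε h B := by
  have := baseFidelity_pos hP hε hh; have := batchLoad_pos (P := P) (B := B)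
  unfold fidelityUnit; positivity

theorem timeUnit_pos (hP : P.Valid M) (hε : 0 < ε) (hh : 0 < h) : 0 < P.timeUnit γ ε h B := by
  have := baseFidelity_pos hP hε hh; have := batchLoad_pos (P := P) (B := B)
  have := queryUnit_pos hP hε
  unfold timeUnit; positivity

theorem smoothingRate_nonneg (hP : P.Valid M) (hB : 0 < B) : 0 ≤ P.smoothingRate h B := by
  have := hP.kappa_pos; have := hP.L_pos; have := batchLoad_pos (P := P) (B := B)
  unfold smoothingRate; positivity

theorem overbatchN_eq (hε : 0 < ε) : P.overbatchN ε = P.R * √P.L / √ε := by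
  rw [overbatchN, show (-1 / 2 : ℝ) = -(1 / 2) by norm_num, Real.rpow_neg hε.le,
    ← Real.sqrt_eq_rpow, div_eq_mul_inv]

theorem baseFidelity_sq (hP : P.Valid M) (hε : 0 < ε) :
    P.baseFidelity ε h ^ 2 = h ^ 2 * √P.L * (ε * √ε) / (P.d * P.R) := by
  have hd := hP.d_pos; have hR := hP.R_pos; have hL := hP.L_pos
  have h1 : (P.L ^ (1 / 4 : ℝ)) ^ 2 = √P.L := by
    rw [← Real.rpow_natCast, ← Real.rpow_mul hL.le, Real.sqrt_eq_rpow]; norm_num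
  have h2 : ((P.d * P.R) ^ (-1 / 2 : ℝ)) ^ 2 = (P.d * P.R)⁻¹ := by
    rw [← Real.rpow_natCast, ← Real.rpow_mul (by positivity), ← Real.rpow_neg_one]; norm_num
  have h3 : (ε ^ (3 / 4 : ℝ)) ^ 2 = ε * √ε := by
    rw [← Real.rpow_natCast, ← Real.rpow_mul hε.le, Real.sqrt_eq_rpow, ← Real.rpow_one_add' hε.le
      (by norm_num)]
    norm_num
  rw [baseFidelity, mul_pow, mul_pow, mul_pow, h1, h2, h3]
  ring

theorem max_one_sq_eq (hP : P.Valid M) (hB : 0 < B) :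
    max 1 ((P.kappa * P.d / B) ^ 2) = (P.batchLoad B * (P.kappa * P.d) / B) ^ 2 := by
  have hκ := hP.kappa_pos; have hd := hP.d_pos
  rcases le_total (P.kappa * P.d) B with hle | hle
  · rw [batchLoad_eq hP hle, max_eq_left]
    · field_simp
    · exact pow_le_one₀ (by positivity) ((div_le_one hB).2 hle)
  · rw [batchLoad, max_eq_left ((div_le_one (by positivity)).2 hle), max_eq_right, one_mul]
    exact one_le_pow₀ ((one_le_div hB).2 hle)

theorem min_eq (hP : P.Valid M) (hB : 0 < B) :
    min (B / P.kappa) (P.kappa * (P.d : ℝ) ^ 2 / B) = B / (P.kappa * P.batchLoad B ^ 2) := by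
  have hκ := hP.kappa_pos; have hd := hP.d_pos
  rcases le_total (P.kappa * P.d) B with hle | hle
  · rw [batchLoad_eq hP hle, min_eq_right]
    · field_simp
    · rw [div_le_div_iff₀ hB hκ]
      nlinarith [mul_self_le_mul_self (by positivity) hle]
  · rw [batchLoad, max_eq_left ((div_le_one (by positivity)).2 hle), min_eq_left]
    · simp
    · rw [div_le_div_iff₀ hκ hB]
      nlinarith [mul_self_le_mul_self hB.le hle]

/-- The error bound in natural units. -/
theorem errorBound_eq (hP : P.Valid M) (hε : 0 < ε) (hh : 0 < h) (hN : 0 < D.N) (hB : 0 < D.B) :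
    P.errorBound D.N D.B D.δ h = ε * (1 / (P.reduce ε h D).1 ^ 2
      + (P.reduce ε h D).1 * (P.smoothingRate h D.B * P.iterUnit ε D.B / ε
        + (P.reduce ε h D).2 ^ 2) + P.Rt * P.bias h / ε) := by
  have hκ := hP.kappa_pos; have hd := hP.d_pos; have hR := hP.R_pos; have hL := hP.L_pos
  have hw := batchLoad_pos (P := P) (B := D.B)
  have hx := iterUnit_pos hP hε hB
  have hL2 : √P.L ^ 2 = P.L := Real.sq_sqrt hL.le
  have he2 : √ε ^ 2 = ε := Real.sq_sqrt hε.le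
  have hl0 : 0 < √P.L := Real.sqrt_pos.2 hL
  have he0 : 0 < √ε := Real.sqrt_pos.2 hε
  have h1 : P.L * P.R ^ 2 / D.N ^ 2 * (P.batchLoad D.B * (P.kappa * P.d) / D.B) ^ 2
      = ε * (1 / (D.N / P.iterUnit ε D.B) ^ 2) := by
    rw [iterUnit, queryUnit, overbatchN_eq hε]
    field_simp
    rw [hL2, he2]
    ring
  have h2 : D.B / (P.kappa * P.batchLoad D.B ^ 2) * (D.δ ^ 2 / (P.L * h ^ 2))
      = ε * (1 / P.iterUnit ε D.B * (D.δ / P.fidelityUnit ε h D.B) ^ 2) := by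
    rw [div_pow D.δ, fidelityUnit, mul_pow, baseFidelity_sq hP hε, Real.sq_sqrt hw.le, iterUnit,
      queryUnit, overbatchN_eq hε]
    field_simp
    rw [hL2]
  rw [errorBound, max_one_sq_eq hP hB, min_eq hP hB, h1]
  simp only [reduce]
  have h3 : ε * (D.N / P.iterUnit ε D.B * (D.δ / P.fidelityUnit ε h D.B) ^ 2)
      = D.N * (D.B / (P.kappa * P.batchLoad D.B ^ 2) * (D.δ ^ 2 / (P.L * h ^ 2))) := by
    rw [h2]; ring
  rw [mul_add (D.N / _), mul_add ε, mul_add ε, mul_add ε, h3, smoothingRate]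
  field_simp
  ring

theorem smoothingRemainder_eq (hP : P.Valid M) (hB : 0 < B) (N : ℝ) :
    P.smoothingRemainder N B h = N * P.smoothingRate h B + P.R * P.bias h := by
  rw [smoothingRemainder, min_eq hP hB, smoothingRate]; ring

theorem mem_feasibleDesigns_iff (hP : P.Valid M) (hε : 0 < ε) (hh : 0 < h) (hB : 0 < D.B) :
    D ∈ feasibleDesigns K P ε h Δ ↔
      P.reduce ε h D ∈ reducedFeasible K (P.smoothingRate h D.B * P.iterUnit ε D.B / ε)
        (P.Rt * P.bias h / ε) (P.cappedFidelities ε h D.B Δ) := by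
  have hx := iterUnit_pos hP hε hB
  have hf := fidelityUnit_pos (B := D.B) hP hε hh
  have h1 : 0 < (P.reduce ε h D).1 ↔ 0 < D.N := div_pos_iff_of_pos_right hx
  have h2 : 0 < (P.reduce ε h D).2 ↔ 0 < D.δ := div_pos_iff_of_pos_right hf
  have h3 : (P.reduce ε h D).2 ∈ P.cappedFidelities ε h D.B Δ ↔ (D.δ : EReal) ≤ Δ := by
    simp only [cappedFidelities, reduce, Set.mem_ofPred_eq]
    rw [mul_div_cancel₀ _ hf.ne']
  simp only [feasibleDesigns, reducedFeasible, Set.mem_ofPred_eq]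
  rw [h1, h2, h3]
  constructor
  · rintro ⟨hN, -, hδ, hΔ, hE⟩
    rw [errorBound_eq hP hε hh hN hB] at hE
    exact ⟨hN, hδ, hΔ, le_of_mul_le_mul_left (by linarith) hε⟩
  · rintro ⟨hN, hδ, hΔ, hE⟩
    refine ⟨hN, hB, hδ, hΔ, ?_⟩
    rw [errorBound_eq hP hε hh hN hB]
    have := mul_le_mul_of_nonneg_left hE hε.le
    linarith

theorem wallClock_eq (hP : P.Valid M) (hε : 0 < ε) (hh : 0 < h) (hB : 0 < D.B) (hδ : 0 < D.δ) :
    D.wallClock γ = P.timeUnit γ ε h D.B * reducedTime γ (P.reduce ε h D) := by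
  have hb := baseFidelity_pos hP hε hh
  have hw := batchLoad_pos (P := P) (B := D.B)
  have hq := queryUnit_pos hP hε
  have hx := iterUnit_pos hP hε hB
  have hf := fidelityUnit_pos (B := D.B) hP hε hh
  have h1 : P.timeUnit γ ε h D.B = D.B * P.iterUnit ε D.B * P.fidelityUnit ε h D.B ^ (-γ) := by
    rw [timeUnit, iterUnit, fidelityUnit, Real.mul_rpow hb.le (Real.sqrt_nonneg _),
      Real.sqrt_eq_rpow, ← Real.rpow_mul hw.le, show 1 - γ / 2 = 1 + 1 / 2 * -γ by ring,
      Real.rpow_add hw, Real.rpow_one]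
    field_simp
  have hfγ : 0 < P.fidelityUnit ε h D.B ^ (-γ) := by positivity
  rw [h1, Design.wallClock, reducedTime, reduce, Real.div_rpow hδ.le hf.le]
  field_simp

/-- The number of iterations and the wall-clock time of any feasible design are at least of the
natural order, and its fidelity is at most of that order. -/
theorem feasibleDesigns.bounds (hP : P.Valid M) (hK : 1 ≤ K) (hγ : 0 < γ) (hε : 0 < ε) (hh : 0 < h)
    (hD : D ∈ feasibleDesigns K P ε h Δ) :
    P.iterUnit ε D.B ≤ D.N ∧ D.N / P.iterUnit ε D.B * (D.δ / P.fidelityUnit ε h D.B) ^ 2 ≤ 1 / K ∧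
      P.timeUnit γ ε h D.B ≤ D.wallClock γ := by
  have hB := hD.2.1
  have hδ := hD.2.2.1
  have hx := iterUnit_pos hP hε hB
  have hb := bias_nonneg hP hh
  have hRt := hP.Rt_nonneg
  have hs := smoothingRate_nonneg (h := h) hP hB
  have hmem := (mem_feasibleDesigns_iff hP hε hh hB).1 hD
  obtain ⟨h1, h2, h3⟩ := reducedFeasible.bounds hK (by positivity) (by positivity) hmem
  refine ⟨(one_le_div hx).1 h1, h2, ?_⟩
  rw [wallClock_eq hP hε hh hB hδ]
  refine le_mul_of_one_le_right (timeUnit_pos hP hε hh).le ?_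
  exact one_le_mul_of_one_le_of_one_le h1
    (Real.one_le_rpow_of_pos_of_le_one_of_nonpos hmem.2.1 h3 (by linarith))

/-- The fixed-batch problem in both regimes. The hypotheses `hσ`, `hρ` say that the smoothing terms
are negligible, and `hv` says that the cap leaves room for a fidelity of the optimal order. -/
theorem exists_isOptimalDesign (hP : P.Valid M) (hK : 1 ≤ K) (hγ : 0 < γ) (hε : 0 < ε) (hh : 0 < h)
    (hB : 0 < B) (hσ : P.smoothingRate h B * P.iterUnit ε B / ε ≤ 1 / (8 * K) ^ 3)
    (hρ : P.Rt * P.bias h / ε ≤ 1 / (8 * K) ^ 3) {v : ℝ}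
    (hv : fidelityFactor γ / (8 * K) ^ 2 ≤ v)
    (hvΔ : ((P.fidelityUnit ε h B * v : ℝ) : EReal) ≤ Δ) :
    (∃ D, IsOptimalDesign γ {D ∈ feasibleDesigns K P ε h Δ | D.B = B} D) ∧
      ∀ D, IsOptimalDesign γ {D ∈ feasibleDesigns K P ε h Δ | D.B = B} D →
        D.N ≤ 8 * K * P.iterUnit ε B ∧
        P.fidelityUnit ε h B * (fidelityFactor γ / (8 * K) ^ 2) ≤ D.δ ∧
        D.δ ≤ 3 * (P.fidelityUnit ε h B * fidelityFactor γ) ∧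
        D.wallClock γ
          ≤ 8 * K * (fidelityFactor γ / (8 * K) ^ 2) ^ (-γ) * P.timeUnit γ ε h B := by
  have hx := iterUnit_pos hP hε hB
  have hf := fidelityUnit_pos (B := B) hP hε hh
  have hb := bias_nonneg hP hh
  have hRt := hP.Rt_nonneg
  have hs := smoothingRate_nonneg (h := h) hP hB
  have ht := timeUnit_pos (γ := γ) (B := B) hP hε hh
  have hG := fidelityFactor_pos hγ
  have hGK : 0 < fidelityFactor γ / (8 * K) ^ 2 := by positivity
  have hσ0 : 0 ≤ P.smoothingRate h B * P.iterUnit ε B / ε := by positivity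
  have hρ0 : 0 ≤ P.Rt * P.bias h / ε := by positivity
  have hI : IsLowerSet (P.cappedFidelities ε h B Δ) := fun a b hba ha =>
    le_trans (EReal.coe_le_coe_iff.2 (mul_le_mul_of_nonneg_left hba hf.le)) ha
  have hIc : IsClosed (P.cappedFidelities ε h B Δ) :=
    isClosed_Iic.preimage (continuous_coe_real_ereal.comp (continuous_const.mul continuous_id))
  -- optimal designs correspond to optimal points of the dimensionless problem
  have hopt : ∀ D : Design, IsOptimalDesign γ {D ∈ feasibleDesigns K P ε h Δ | D.B = B} D ↔
      D.B = B ∧ IsReducedOptimal K (P.smoothingRate h B * P.iterUnit ε B / ε)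
        (P.Rt * P.bias h / ε) γ (P.cappedFidelities ε h B Δ) (P.reduce ε h D) := by
    intro D
    constructor
    · rintro ⟨⟨hD, rfl⟩, hmin⟩
      have hmem := (mem_feasibleDesigns_iff hP hε hh hB).1 hD
      refine ⟨rfl, hmem, fun q hq => ?_⟩
      let D' : Design := ⟨q.1 * P.iterUnit ε D.B, D.B, q.2 * P.fidelityUnit ε h D.B⟩
      have hD' : P.reduce ε h D' = q := by
        simp only [reduce, D', mul_div_cancel_right₀ _ hx.ne', mul_div_cancel_right₀ _ hf.ne']
      have hmem' : D' ∈ feasibleDesigns K P ε h Δ := by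
        rw [mem_feasibleDesigns_iff (D := D') hP hε hh hB, hD']; exact hq
      have := hmin D' ⟨hmem', rfl⟩
      rw [wallClock_eq hP hε hh hB hD.2.2.1, wallClock_eq (D := D') hP hε hh hB hmem'.2.2.1,
        hD'] at this
      exact le_of_mul_le_mul_left this ht
    · rintro ⟨rfl, hmem, hmin⟩
      have hD := (mem_feasibleDesigns_iff hP hε hh hB).2 hmem
      refine ⟨⟨hD, rfl⟩, fun D' ⟨hD', hD'B⟩ => ?_⟩
      have hB' : 0 < D'.B := by rw [hD'B]; exact hB
      have hmem' := (mem_feasibleDesigns_iff hP hε hh hB').1 hD'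
      rw [wallClock_eq hP hε hh hB hD.2.2.1, wallClock_eq hP hε hh hB' hD'.2.2.1, hD'B]
      rw [hD'B] at hmem'
      exact mul_le_mul_of_nonneg_left (hmin _ hmem') ht.le
  constructor
  · obtain ⟨p, hp⟩ := exists_isReducedOptimal (γ := γ) hK hσ0 hρ0 hσ hρ hγ hI hIc
      (hGK.trans_le hv) hvΔ
    refine ⟨⟨p.1 * P.iterUnit ε B, B, p.2 * P.fidelityUnit ε h B⟩, (hopt _).2 ⟨rfl, ?_⟩⟩
    simp only [reduce, mul_div_cancel_right₀ _ hx.ne', mul_div_cancel_right₀ _ hf.ne']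
    exact hp
  · intro D hD
    have hδ : 0 < D.δ := hD.1.1.2.2.1
    obtain ⟨rfl, hp⟩ := (hopt D).1 hD
    have h1 := hp.fst_le hK hσ0 hρ0 hσ hρ
    obtain ⟨h2, h3⟩ := hp.snd_bounds hK hσ0 hρ0 hσ hρ hγ hI hvΔ hv
    refine ⟨(div_le_iff₀ hx).1 h1, ?_, ?_, ?_⟩
    · rw [mul_comm]; exact (le_div_iff₀ hf).1 h2
    · have := (div_le_iff₀ hf).1 h3; linarith
    · rw [wallClock_eq hP hε hh hB hδ, mul_comm]
      refine mul_le_mul_of_nonneg_right ?_ ht.le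
      exact mul_le_mul h1 (Real.rpow_le_rpow_of_nonpos hGK h2 (by linarith))
        (Real.rpow_nonneg hp.1.2.1.le _) (by positivity)

/-! ### The natural scales in closed form -/

theorem Valid.exists_exp (hP : P.Valid M) (hε : 0 < ε) (hh : 0 < h) : ∃ k d R L e g : ℝ,
    Real.exp k = P.kappa ∧ Real.exp d = P.d ∧ Real.exp R = P.R ∧ Real.exp L = P.L ∧
      Real.exp e = ε ∧ Real.exp g = h :=
  ⟨_, _, _, _, _, _, Real.exp_log hP.kappa_pos, Real.exp_log hP.d_pos, Real.exp_log hP.R_pos,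
    Real.exp_log hP.L_pos, Real.exp_log hε, Real.exp_log hh⟩

theorem queryUnit_mul_rpow (hP : P.Valid M) (hε : 0 < ε) (hh : 0 < h) :
    P.queryUnit ε * P.baseFidelity ε h ^ (-γ) = P.smallBatchTime γ ε h := by
  obtain ⟨k, d, R, L, e, g, hk, hd, hR, hL, he, hg⟩ := hP.exists_exp hε hh
  rw [queryUnit, overbatchN, baseFidelity, smallBatchTime, ← hk, ← hd, ← hR, ← hL, ← he, ← hg]
  simp only [Real.sqrt_eq_rpow, ← Real.exp_mul, ← Real.exp_add]
  congr 1
  ring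

theorem timeUnit_eq_smallBatchTime_mul (hP : P.Valid M) (hε : 0 < ε) (hh : 0 < h) :
    P.timeUnit γ ε h B = P.smallBatchTime γ ε h * P.batchLoad B ^ (1 - γ / 2) := by
  rw [timeUnit, queryUnit_mul_rpow hP hε hh]

theorem timeUnit_eq_largeBatchTime (hP : P.Valid M) (hε : 0 < ε) (hh : 0 < h) (hB : 0 < B)
    (hκB : P.kappa * P.d ≤ B) :
    P.timeUnit γ ε h B = P.largeBatchTimeFactor γ ε h * B ^ (1 - γ / 2) := by
  rw [timeUnit_eq_smallBatchTime_mul hP hε hh, batchLoad_eq hP hκB]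
  obtain ⟨k, d, R, L, e, g, hk, hd, hR, hL, he, hg⟩ := hP.exists_exp hε hh
  obtain ⟨b, rfl⟩ : ∃ b, Real.exp b = B := ⟨_, Real.exp_log hB⟩
  rw [largeBatchTimeFactor, smallBatchTime, ← hk, ← hd, ← hR, ← hL, ← he, ← hg]
  simp only [← Real.exp_add, ← Real.exp_sub, ← Real.exp_mul]
  congr 1
  ring

theorem fidelityUnit_mul_factor (hP : P.Valid M) (hε : 0 < ε) (hh : 0 < h) (hB : 0 < B)
    (hκB : P.kappa * P.d ≤ B) :
    P.fidelityUnit ε h B * fidelityFactor γ = P.largeBatchFidelity γ ε h B := by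
  rw [largeBatchFidelity, fidelityUnit, batchLoad_eq hP hκB, baseFidelity]
  congr 1
  obtain ⟨k, d, R, L, e, g, hk, hd, hR, hL, he, hg⟩ := hP.exists_exp hε hh
  obtain ⟨b, rfl⟩ : ∃ b, Real.exp b = B := ⟨_, Real.exp_log hB⟩
  rw [← hk, ← hd, ← hR, ← hL, ← he, ← hg]
  simp only [Real.sqrt_eq_rpow, ← Real.exp_nat_mul, ← Real.exp_add, ← Real.exp_sub, ← Real.exp_mul]
  congr 1
  push_cast
  ring

theorem iterUnit_eq_overbatchN (hP : P.Valid M) (hB : 0 < B) (hκB : P.kappa * P.d ≤ B) :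
    P.iterUnit ε B = P.overbatchN ε := by
  have hκ := hP.kappa_pos; have hd := hP.d_pos
  rw [iterUnit, queryUnit, batchLoad_eq hP hκB]
  field_simp

theorem fidelityUnit_sq_mul_iterUnit (hP : P.Valid M) (hε : 0 < ε) (hB : 0 < B)
    (hκB : P.kappa * P.d ≤ B) :
    P.fidelityUnit ε h B ^ 2 * P.iterUnit ε B
      = ε * B * P.L * h ^ 2 / (P.kappa * (P.d : ℝ) ^ 2) := by
  have hκ := hP.kappa_pos; have hd := hP.d_pos; have hR := hP.R_pos
  have he0 : 0 < √ε := Real.sqrt_pos.2 hε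
  rw [iterUnit_eq_overbatchN hP hB hκB, fidelityUnit, mul_pow, baseFidelity_sq hP hε,
    Real.sq_sqrt batchLoad_pos.le, batchLoad_eq hP hκB, overbatchN_eq hε]
  field_simp
  rw [Real.sq_sqrt hP.L_pos.le]

theorem overbatchB_eq (hP : P.Valid M) (hε : 0 < ε) (hh : 0 < h) :
    P.overbatchB ε h = P.kappa * P.d / P.baseFidelity ε h ^ 2 := by
  obtain ⟨k, d, R, L, e, g, hk, hd, hR, hL, he, hg⟩ := hP.exists_exp hε hh
  rw [overbatchB, baseFidelity, ← hk, ← hd, ← hR, ← hL, ← he, ← hg]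
  simp only [← Real.exp_nat_mul, ← Real.exp_mul, ← Real.exp_add, ← Real.exp_sub]
  congr 1
  push_cast
  ring

theorem overbatchTime_eq (hP : P.Valid M) (hε : 0 < ε) (hh : 0 < h) :
    P.overbatchTime ε h = P.overbatchB ε h * P.overbatchN ε := by
  obtain ⟨k, d, R, L, e, g, hk, hd, hR, hL, he, hg⟩ := hP.exists_exp hε hh
  rw [overbatchTime, overbatchB, overbatchN, ← hk, ← hd, ← hR, ← hL, ← he, ← hg]
  simp only [Real.sqrt_eq_rpow, ← Real.exp_nat_mul, ← Real.exp_mul, ← Real.exp_add]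
  congr 1
  push_cast
  ring

theorem overbatchTime_eq_mul_smallBatchTime (hP : P.Valid M) (hε : 0 < ε) (hh : 0 < h) :
    P.overbatchTime ε h = P.baseFidelity ε h ^ (γ - 2) * P.smallBatchTime γ ε h := by
  obtain ⟨k, d, R, L, e, g, hk, hd, hR, hL, he, hg⟩ := hP.exists_exp hε hh
  rw [overbatchTime, baseFidelity, smallBatchTime, ← hk, ← hd, ← hR, ← hL, ← he, ← hg]
  simp only [← Real.exp_nat_mul, ← Real.exp_mul, ← Real.exp_add]
  congr 1
  push_cast
  ring

/-! ### The smoothing terms -/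

/-- The level `c₀` below which the smoothing terms are negligible. -/
def smoothingLevel (K M : ℝ) : ℝ := 1 / ((8 * K) ^ 3 * (4 + M))

theorem smoothing_negligible (hP : P.Valid M) (hK : 1 ≤ K) (hM : 0 ≤ M) (hε : 0 < ε) (hh : 0 < h)
    (hB : 0 < B) {N : ℝ} (hN : P.iterUnit ε B ≤ 4 * N)
    (hS : P.smoothingRemainder N B h ≤ smoothingLevel K M * ε) :
    P.smoothingRate h B * P.iterUnit ε B / ε ≤ 1 / (8 * K) ^ 3 ∧
      P.Rt * P.bias h / ε ≤ 1 / (8 * K) ^ 3 := by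
  have hx := iterUnit_pos hP hε hB
  have hs := smoothingRate_nonneg (h := h) hP hB
  have hb := bias_nonneg hP hh
  have hR := hP.R_pos
  have hK0 : 0 < 8 * K := by linarith
  have hc : smoothingLevel K M * (4 + M) = 1 / (8 * K) ^ 3 := by
    unfold smoothingLevel; field_simp
  have hc0 : 0 < smoothingLevel K M := by unfold smoothingLevel; positivity
  rw [smoothingRemainder_eq hP hB] at hS
  have hsN : 0 ≤ N * P.smoothingRate h B := mul_nonneg (by linarith) hs
  have hRb : 0 ≤ P.R * P.bias h := by positivity
  have hcε : 0 < smoothingLevel K M * ε := by positivity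
  have hMc : 0 ≤ M * (smoothingLevel K M * ε) := by positivity
  rw [div_le_iff₀ hε, div_le_iff₀ hε, ← hc]
  constructor
  · nlinarith [mul_le_mul_of_nonneg_right hN hs]
  · calc P.Rt * P.bias h ≤ M * P.R * P.bias h := by gcongr; exact hP.Rt_le
      _ ≤ M * (smoothingLevel K M * ε) := by
        rw [mul_assoc]
        exact mul_le_mul_of_nonneg_left (by linarith) hM
      _ ≤ _ := by linarith

theorem one_le_exponentRatio (hγ : 0 < γ) :
    1 ≤ ((2 + 3 * γ) / (2 + γ)) ^ (1 / 2 : ℝ) := by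
  refine Real.one_le_rpow ?_ (by norm_num)
  rw [one_le_div (by positivity)]; linarith

theorem exponentRatio_le_two (hγ : 0 < γ) :
    ((2 + 3 * γ) / (2 + γ)) ^ (1 / 2 : ℝ) ≤ 2 := by
  rw [← Real.sqrt_eq_rpow, Real.sqrt_le_left (by norm_num), div_le_iff₀ (by positivity)]
  linarith

theorem smallBatchQ_eq : P.smallBatchQ γ ε
    = P.queryUnit ε * ((2 + 3 * γ) / (2 + γ)) ^ (1 / 2 : ℝ) := by
  rw [smallBatchQ, queryUnit, overbatchN]; ring

theorem largeBatchN_eq : P.largeBatchN γ ε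
    = P.overbatchN ε * ((2 + 3 * γ) / (2 + γ)) ^ (1 / 2 : ℝ) := rfl

theorem batchLoad_rpow_le (hP : P.Valid M) (hγ : 0 < γ) (hB : B ≤ 4 * P.kappa * P.d) :
    P.batchLoad B ^ (1 - γ / 2) ≤ 4 :=
  calc P.batchLoad B ^ (1 - γ / 2) ≤ P.batchLoad B ^ (1 : ℝ) :=
        Real.rpow_le_rpow_of_exponent_le one_le_batchLoad (by linarith)
    _ ≤ 4 := by rw [Real.rpow_one]; exact batchLoad_le_four hP hB

theorem le_batchLoad_rpow (hP : P.Valid M) (hγ : 0 < γ) (hB : B ≤ 4 * P.kappa * P.d) :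
    2 ^ (-γ) ≤ P.batchLoad B ^ (1 - γ / 2) :=
  calc (2 : ℝ) ^ (-γ) = 4 ^ (-(γ / 2)) := by
        rw [show (4 : ℝ) = 2 ^ (2 : ℝ) by norm_num, ← Real.rpow_mul (by norm_num)]
        congr 1; ring
    _ ≤ P.batchLoad B ^ (-(γ / 2)) :=
        Real.rpow_le_rpow_of_nonpos batchLoad_pos (batchLoad_le_four hP hB) (by linarith)
    _ ≤ P.batchLoad B ^ (1 - γ / 2) :=
        Real.rpow_le_rpow_of_exponent_le one_le_batchLoad (by linarith)

/-! ### Constants -/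

/-- Lower constant, depending on `γ`. -/
def lowerConst (K γ : ℝ) : ℝ := min (2 ^ (-γ)) ((fidelityFactor γ / (8 * K) ^ 2) ^ 2)

/-- Upper constant, depending on `γ`. -/
def upperConst (K γ : ℝ) : ℝ :=
  32 * K * (fidelityFactor γ / (8 * K) ^ 2) ^ (-γ) + 16 * K ^ 3 * 2 ^ γ

theorem lowerConst_pos (hK : 1 ≤ K) (hγ : 0 < γ) : 0 < lowerConst K γ := by
  have := fidelityFactor_pos hγ
  unfold lowerConst
  exact lt_min (by positivity) (by positivity)

theorem upperConst_bounds (hK : 1 ≤ K) (hγ : 0 < γ) :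
    32 * K * (fidelityFactor γ / (8 * K) ^ 2) ^ (-γ) ≤ upperConst K γ ∧
      16 * K ^ 3 * 2 ^ γ ≤ upperConst K γ := by
  have := fidelityFactor_pos hγ
  unfold upperConst
  have h1 : 0 < 32 * K * (fidelityFactor γ / (8 * K) ^ 2) ^ (-γ) := by positivity
  have h2 : 0 < 16 * K ^ 3 * 2 ^ γ := by positivity
  constructor <;> linarith

theorem one_le_upperConst (hK : 1 ≤ K) (hγ : 0 < γ) : 1 ≤ upperConst K γ := by
  refine le_trans ?_ (upperConst_bounds hK hγ).2
  have h1 : 1 ≤ (2 : ℝ) ^ γ := Real.one_le_rpow (by norm_num) hγ.le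
  have h2 : 1 ≤ K ^ 3 := one_le_pow₀ hK
  nlinarith

/-! ### Small batches -/

/-- For `B ≤ 4 κ d` the load lies in `[1, 4]`, so all natural scales agree with those at load `1`. -/
theorem small_batch (hP : P.Valid M) (hK : 1 ≤ K) (hM : 0 ≤ M) (hγ : 0 < γ) (hε : 0 < ε)
    (hh : 0 < h) (hB : 0 < B) (hB4 : B ≤ 4 * P.kappa * P.d)
    (hΔ : (P.smallBatchFidelity γ ε h : EReal) ≤ Δ)
    (hS : P.smoothingRemainder (P.smallBatchQ γ ε / B) B h ≤ smoothingLevel K M * ε) :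
    (∃ D, IsOptimalDesign γ {D ∈ feasibleDesigns K P ε h Δ | D.B = B} D) ∧
      ∀ D, IsOptimalDesign γ {D ∈ feasibleDesigns K P ε h Δ | D.B = B} D →
        SameOrder (1 / (8 * K) ^ 2) (32 * K ^ 3) D.Q (P.smallBatchQ γ ε) ∧
        SameOrder (1 / (8 * K) ^ 2) (32 * K ^ 3) D.δ (P.smallBatchFidelity γ ε h) ∧
        SameOrder (lowerConst K γ) (upperConst K γ) (D.wallClock γ) (P.smallBatchTime γ ε h) ∧
        (γ ≤ 2 → ∀ D' ∈ feasibleDesigns K P ε h Δ, 4 * P.kappa * P.d < D'.B →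
          D.wallClock γ ≤ upperConst K γ * D'.wallClock γ) := by
  have hκ := hP.kappa_pos; have hd := hP.d_pos
  have hq := queryUnit_pos hP hε
  have hbase := baseFidelity_pos hP hε hh
  have hw1 := one_le_batchLoad (P := P) (B := B)
  have hw4 := batchLoad_le_four hP hB4
  have hw0 := batchLoad_pos (P := P) (B := B)
  have hG := fidelityFactor_pos hγ
  have hg1 := one_le_exponentRatio hγ
  have hg2 := exponentRatio_le_two hγ
  have hK0 : 0 < K := by linarith
  have hK2 : 1 ≤ K ^ 2 := one_le_pow₀ hK
  have hK3 : K ≤ K ^ 3 := le_self_pow₀ hK (by norm_num)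
  have hs1 : 1 ≤ √(P.batchLoad B) := Real.one_le_sqrt.2 hw1
  have hs2 : √(P.batchLoad B) ≤ 2 := by
    rw [Real.sqrt_le_left (by norm_num)]; linarith
  have hN : P.iterUnit ε B ≤ 4 * (P.smallBatchQ γ ε / B) := by
    rw [iterUnit, smallBatchQ_eq, ← mul_div_assoc]
    refine div_le_div_of_nonneg_right ?_ hB.le
    nlinarith
  obtain ⟨hσ, hρ⟩ := smoothing_negligible hP hK hM hε hh hB hN hS
  -- in natural units the reference fidelity `baseFidelity · G(γ)` is `G(γ) / √w`
  have hv : fidelityFactor γ / (8 * K) ^ 2 ≤ fidelityFactor γ / √(P.batchLoad B) := by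
    gcongr; nlinarith
  have hvΔ : ((P.fidelityUnit ε h B * (fidelityFactor γ / √(P.batchLoad B)) : ℝ) : EReal) ≤ Δ := by
    convert hΔ using 2
    rw [fidelityUnit, smallBatchFidelity]
    field_simp
  obtain ⟨hex, hall⟩ := exists_isOptimalDesign hP hK hγ hε hh hB hσ hρ hv hvΔ
  refine ⟨hex, fun D hD => ?_⟩
  obtain ⟨h1, h2, h3, h4⟩ := hall D hD
  obtain ⟨⟨hDf, rfl⟩, -⟩ := hD
  obtain ⟨hlN, -, hlT⟩ := feasibleDesigns.bounds hP hK hγ hε hh hDf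
  have hT0 : 0 < P.smallBatchTime γ ε h := by rw [← queryUnit_mul_rpow hP hε hh]; positivity
  have hBx : D.B * P.iterUnit ε D.B = P.queryUnit ε * P.batchLoad D.B := by
    rw [iterUnit]; field_simp
  have hupper : D.wallClock γ ≤ upperConst K γ * P.smallBatchTime γ ε h := by
    have hpow := batchLoad_rpow_le hP hγ hB4
    have hGp : 0 < (fidelityFactor γ / (8 * K) ^ 2) ^ (-γ) := by positivity
    calc D.wallClock γ
        ≤ 8 * K * (fidelityFactor γ / (8 * K) ^ 2) ^ (-γ) * P.timeUnit γ ε h D.B := h4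
      _ ≤ 8 * K * (fidelityFactor γ / (8 * K) ^ 2) ^ (-γ) * (P.smallBatchTime γ ε h * 4) := by
          rw [timeUnit_eq_smallBatchTime_mul hP hε hh]; gcongr
      _ = 32 * K * (fidelityFactor γ / (8 * K) ^ 2) ^ (-γ) * P.smallBatchTime γ ε h := by ring
      _ ≤ _ := by gcongr; exact (upperConst_bounds hK hγ).1
  refine ⟨⟨?_, ?_⟩, ⟨?_, ?_⟩, ⟨?_, hupper⟩, fun hγ2 D' hD' hD'B => ?_⟩
  · rw [smallBatchQ_eq, Design.Q]
    calc 1 / (8 * K) ^ 2 * (P.queryUnit ε * ((2 + 3 * γ) / (2 + γ)) ^ (1 / 2 : ℝ))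
        ≤ 1 / 2 * (P.queryUnit ε * 2) := by gcongr; nlinarith
      _ ≤ P.queryUnit ε * P.batchLoad D.B := by nlinarith
      _ ≤ D.B * D.N := by rw [← hBx]; gcongr
  · rw [smallBatchQ_eq, Design.Q]
    calc D.B * D.N ≤ D.B * (8 * K * P.iterUnit ε D.B) := by gcongr
      _ = 8 * K * (P.queryUnit ε * P.batchLoad D.B) := by rw [← hBx]; ring
      _ ≤ 8 * K ^ 3 * (P.queryUnit ε * 4) := by gcongr
      _ = 32 * K ^ 3 * (P.queryUnit ε * 1) := by ring
      _ ≤ _ := by gcongr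
  · refine le_trans ?_ h2
    rw [smallBatchFidelity, fidelityUnit]
    calc 1 / (8 * K) ^ 2 * (P.baseFidelity ε h * fidelityFactor γ)
        = P.baseFidelity ε h * 1 * (fidelityFactor γ / (8 * K) ^ 2) := by ring
      _ ≤ _ := by gcongr
  · refine h3.trans ?_
    rw [smallBatchFidelity, fidelityUnit]
    calc 3 * (P.baseFidelity ε h * √(P.batchLoad D.B) * fidelityFactor γ)
        ≤ 3 * (P.baseFidelity ε h * 2 * fidelityFactor γ) := by gcongr
      _ = 6 * (P.baseFidelity ε h * fidelityFactor γ) := by ring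
      _ ≤ _ := by gcongr; nlinarith
  · refine le_trans ?_ hlT
    rw [timeUnit_eq_smallBatchTime_mul hP hε hh, mul_comm]
    gcongr
    exact (min_le_left _ _).trans (le_batchLoad_rpow hP hγ hB4)
  · refine hupper.trans ?_
    have hu := one_le_upperConst hK hγ
    gcongr
    refine le_trans ?_ (feasibleDesigns.bounds hP hK hγ hε hh hD').2.2
    rw [timeUnit_eq_smallBatchTime_mul hP hε hh]
    exact le_mul_of_one_le_right hT0.le (Real.one_le_rpow one_le_batchLoad (by linarith))

/-! ### Large batches -/

/-- For `B > 4 κ d` the load is `B / (κ d)`, whence the power `B^(1 - γ/2)` in the time. -/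
theorem large_batch (hP : P.Valid M) (hK : 1 ≤ K) (hM : 0 ≤ M) (hγ : 0 < γ) (hε : 0 < ε)
    (hh : 0 < h) (hB4 : 4 * P.kappa * P.d < B)
    (hΔ : (P.largeBatchFidelity γ ε h B : EReal) ≤ Δ)
    (hS : P.smoothingRemainder (P.largeBatchN γ ε) B h ≤ smoothingLevel K M * ε) :
    (∃ D, IsOptimalDesign γ {D ∈ feasibleDesigns K P ε h Δ | D.B = B} D) ∧
      ∀ D, IsOptimalDesign γ {D ∈ feasibleDesigns K P ε h Δ | D.B = B} D →
        SameOrder (lowerConst K γ) (upperConst K γ) (D.δ ^ 2)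
          (ε * B * P.L * h ^ 2 / (D.N * P.kappa * (P.d : ℝ) ^ 2)) ∧
        SameOrder (lowerConst K γ) (upperConst K γ) (D.wallClock γ)
          (P.largeBatchTimeFactor γ ε h * B ^ (1 - γ / 2)) := by
  have hκ := hP.kappa_pos; have hd := hP.d_pos
  have hκB := (hP.kappa_mul_d_lt hB4).le
  have hB : 0 < B := lt_of_lt_of_le (by positivity) hκB
  have hG := fidelityFactor_pos hγ
  have hK0 : 0 < K := by linarith
  have hK2 : 1 ≤ K ^ 2 := one_le_pow₀ hK
  have hx := iterUnit_pos hP hε hB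
  have hf := fidelityUnit_pos (B := B) hP hε hh
  have ht := timeUnit_pos (γ := γ) (B := B) hP hε hh
  have hN : P.iterUnit ε B ≤ 4 * P.largeBatchN γ ε := by
    rw [iterUnit_eq_overbatchN hP hB hκB, largeBatchN_eq]
    nlinarith [one_le_exponentRatio hγ, overbatchN_pos hP hε]
  obtain ⟨hσ, hρ⟩ := smoothing_negligible hP hK hM hε hh hB hN hS
  have hv : fidelityFactor γ / (8 * K) ^ 2 ≤ fidelityFactor γ :=
    div_le_self hG.le (by nlinarith)
  obtain ⟨hex, hall⟩ := exists_isOptimalDesign hP hK hγ hε hh hB hσ hρ hv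
    (Δ := Δ) (by rwa [fidelityUnit_mul_factor hP hε hh hB hκB])
  refine ⟨hex, fun D hD => ?_⟩
  obtain ⟨h1, h2, h3, h4⟩ := hall D hD
  obtain ⟨⟨hDf, rfl⟩, -⟩ := hD
  obtain ⟨hlN, huv, hlT⟩ := feasibleDesigns.bounds hP hK hγ hε hh hDf
  have hN0 := hDf.1
  rw [← timeUnit_eq_largeBatchTime hP hε hh hB hκB]
  have href : ε * D.B * P.L * h ^ 2 / (D.N * P.kappa * (P.d : ℝ) ^ 2)
      = P.fidelityUnit ε h D.B ^ 2 * (P.iterUnit ε D.B / D.N) := by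
    rw [← mul_div_assoc, fidelityUnit_sq_mul_iterUnit hP hε hB hκB]
    field_simp
  rw [href]
  refine ⟨⟨?_, ?_⟩, ⟨?_, ?_⟩⟩
  · calc lowerConst K γ * (P.fidelityUnit ε h D.B ^ 2 * (P.iterUnit ε D.B / D.N))
        ≤ (fidelityFactor γ / (8 * K) ^ 2) ^ 2 * (P.fidelityUnit ε h D.B ^ 2 * 1) := by
          gcongr
          · exact min_le_right _ _
          · exact (div_le_one hN0).2 hlN
      _ = (P.fidelityUnit ε h D.B * (fidelityFactor γ / (8 * K) ^ 2)) ^ 2 := by ring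
      _ ≤ D.δ ^ 2 := by gcongr
  · have huv1 : D.N / P.iterUnit ε D.B * (D.δ / P.fidelityUnit ε h D.B) ^ 2 ≤ 1 :=
      huv.trans ((div_le_one hK0).2 hK)
    calc D.δ ^ 2 = P.fidelityUnit ε h D.B ^ 2 * (P.iterUnit ε D.B / D.N)
          * (D.N / P.iterUnit ε D.B * (D.δ / P.fidelityUnit ε h D.B) ^ 2) := by field_simp
      _ ≤ P.fidelityUnit ε h D.B ^ 2 * (P.iterUnit ε D.B / D.N) * 1 := by gcongr
      _ ≤ _ := by
          rw [mul_comm]; gcongr; exact one_le_upperConst hK hγ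
  · refine le_trans (mul_le_of_le_one_left ht.le ((min_le_left _ _).trans ?_)) hlT
    exact Real.rpow_le_one_of_one_le_of_nonpos (by norm_num) (by linarith)
  · refine h4.trans ?_
    gcongr
    refine le_trans ?_ (upperConst_bounds hK hγ).1
    gcongr
    norm_num

/-! ### Overbatching -/

theorem errorBound_of_kappa_mul_d_le (hP : P.Valid M) (hB : 0 < B) (hκB : P.kappa * P.d ≤ B)
    (N δ : ℝ) : P.errorBound N B δ h = P.L * P.R ^ 2 / N ^ 2
      + N * (P.kappa * (P.d : ℝ) ^ 2 / B) * (P.L * h ^ 2 / P.d + δ ^ 2 / (P.L * h ^ 2))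
      + P.Rt * P.bias h + N * P.bias h ^ 2 / P.L := by
  have hκ := hP.kappa_pos; have hd := hP.d_pos
  have h1 : P.batchLoad B * (P.kappa * P.d) / B = 1 := by
    rw [batchLoad_eq hP hκB]; field_simp
  have h2 : B / (P.kappa * P.batchLoad B ^ 2) = P.kappa * (P.d : ℝ) ^ 2 / B := by
    rw [batchLoad_eq hP hκB]; field_simp
  rw [errorBound, max_one_sq_eq hP hB, min_eq hP hB, h1, h2]
  ring

theorem smoothingRate_anti (hP : P.Valid M) {B' : ℝ} (hκB : P.kappa * P.d < B) (hBB' : B ≤ B') :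
    P.smoothingRate h B' ≤ P.smoothingRate h B := by
  have hκ := hP.kappa_pos; have hd := hP.d_pos; have hL := hP.L_pos
  have hB : 0 < B := lt_trans (by positivity) hκB
  have hB' : 0 < B' := hB.trans_le hBB'
  have h1 : ∀ b, 0 < b → P.kappa * P.d ≤ b →
      b / (P.kappa * P.batchLoad b ^ 2) = P.kappa * (P.d : ℝ) ^ 2 / b := fun b hb hκb => by
    rw [batchLoad_eq hP hκb]; field_simp
  rw [smoothingRate, smoothingRate, h1 B hB hκB.le, h1 B' hB' (hκB.le.trans hBB')]
  gcongr

/-- Replacing `(B, δ)` by `(B / δ², 1)` preserves feasibility. -/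
theorem feasibleDesigns.full_fidelity (hP : P.Valid M) (hK : 1 ≤ K) (hh : 0 < h)
    (hD : D ∈ feasibleDesigns K P ε h 1) (hB4 : 4 * P.kappa * P.d < D.B) :
    (⟨D.N, D.B / D.δ ^ 2, 1⟩ : Design) ∈
      {D ∈ feasibleDesigns K P ε h 1 | 4 * P.kappa * P.d < D.B} := by
  obtain ⟨hN, hB, hδ, hδ1, hE⟩ := hD
  have hδ1 : D.δ ≤ 1 := by exact_mod_cast hδ1
  have hκ := hP.kappa_pos; have hd := hP.d_pos; have hL := hP.L_pos
  have hκB := (hP.kappa_mul_d_lt hB4).le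
  have hδ2 : D.δ ^ 2 ≤ 1 := pow_le_one₀ hδ.le hδ1
  have hBle : D.B ≤ D.B / D.δ ^ 2 := by
    rw [le_div_iff₀ (by positivity)]; nlinarith
  have hB' : 0 < D.B / D.δ ^ 2 := by positivity
  refine ⟨⟨hN, hB', one_pos, le_rfl, ?_⟩, hB4.trans_le hBle⟩
  refine le_trans ?_ hE
  dsimp only
  rw [errorBound_of_kappa_mul_d_le hP hB' (hκB.trans hBle), errorBound_of_kappa_mul_d_le hP hB hκB]
  have h1 : D.N * (P.kappa * (P.d : ℝ) ^ 2 / (D.B / D.δ ^ 2))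
        * (P.L * h ^ 2 / P.d + 1 ^ 2 / (P.L * h ^ 2))
      ≤ D.N * (P.kappa * (P.d : ℝ) ^ 2 / D.B)
        * (P.L * h ^ 2 / P.d + D.δ ^ 2 / (P.L * h ^ 2)) := by
    calc _ = D.N * (P.kappa * (P.d : ℝ) ^ 2 / D.B)
        * (P.L * h ^ 2 / P.d * D.δ ^ 2 + D.δ ^ 2 / (P.L * h ^ 2)) := by field_simp
      _ ≤ _ := by
        gcongr
        exact mul_le_of_le_one_right (by positivity) hδ2
  gcongr

/-- At full fidelity, every feasible large-batch design is bounded below by the overbatching scales.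
-/
theorem feasibleDesigns.overbatch_le (hP : P.Valid M) (hK : 1 ≤ K) (hε : 0 < ε) (hh : 0 < h)
    (hD : D ∈ feasibleDesigns K P ε h Δ) (hB4 : 4 * P.kappa * P.d < D.B) (hδ : D.δ = 1) :
    P.overbatchN ε ≤ D.N ∧ P.overbatchB ε h ≤ D.B := by
  have hκ := hP.kappa_pos; have hd := hP.d_pos
  have hB := hD.2.1
  have hb := baseFidelity_pos hP hε hh
  have hκB := (hP.kappa_mul_d_lt hB4).le
  have hx := iterUnit_pos hP hε hB
  obtain ⟨h1, h2, -⟩ := feasibleDesigns.bounds hP hK one_pos hε hh hD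
  refine ⟨by rwa [iterUnit_eq_overbatchN hP hB hκB] at h1, ?_⟩
  have h3 : 1 ≤ D.N / P.iterUnit ε D.B := (one_le_div hx).2 h1
  have h4 : (D.δ / P.fidelityUnit ε h D.B) ^ 2 ≤ 1 := by
    have : 1 / K ≤ 1 := (div_le_one (by linarith)).2 hK
    nlinarith [sq_nonneg (D.δ / P.fidelityUnit ε h D.B)]
  rw [hδ, div_pow, one_pow, fidelityUnit, mul_pow, Real.sq_sqrt batchLoad_pos.le,
    batchLoad_eq hP hκB, div_le_one (by positivity), ← mul_div_assoc,
    le_div_iff₀ (by positivity)] at h4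
  rw [overbatchB_eq hP hε hh, div_le_iff₀ (by positivity)]
  linarith

theorem isCompact_fullFidelity_inter (hP : P.Valid M) {n b : ℝ} (hn : 0 < n)
    (hκb : P.kappa * P.d < b) (n' b' : ℝ) :
    IsCompact ({q : ℝ × ℝ | K * P.errorBound q.1 q.2 1 h ≤ ε}
      ∩ Set.Icc n n' ×ˢ Set.Icc b b') := by
  have hκ := hP.kappa_pos; have hd := hP.d_pos
  have hb0 : 0 < b := lt_trans (by positivity) hκb
  have hc : ContinuousOn (fun q : ℝ × ℝ => K * P.errorBound q.1 q.2 1 h)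
      (Set.Icc n n' ×ˢ Set.Icc b b') := by
    have hcongr : ∀ q ∈ Set.Icc n n' ×ˢ Set.Icc b b', K * P.errorBound q.1 q.2 1 h
        = K * (P.L * P.R ^ 2 / q.1 ^ 2 + q.1 * (P.kappa * (P.d : ℝ) ^ 2 / q.2)
          * (P.L * h ^ 2 / P.d + 1 ^ 2 / (P.L * h ^ 2))
          + P.Rt * P.bias h + q.1 * P.bias h ^ 2 / P.L) := fun q hq => by
      rw [errorBound_of_kappa_mul_d_le hP (hb0.trans_le hq.2.1) (hκb.le.trans hq.2.1)]
    refine ContinuousOn.congr ?_ hcongr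
    refine continuousOn_const.mul ((((continuousOn_const.div (by fun_prop) ?_).add
      ((continuousOn_fst.mul (continuousOn_const.div continuousOn_snd ?_)).mul
        continuousOn_const)).add continuousOn_const).add (by fun_prop))
    · intro q hq
      have : 0 < q.1 := hn.trans_le hq.1.1
      positivity
    · intro q hq
      exact (hb0.trans_le hq.2.1).ne'
  rw [Set.inter_comm]
  exact IsCompact.of_isClosed_subset (isCompact_Icc.prod isCompact_Icc)
    (hc.preimage_isClosed_of_isClosed (isClosed_Icc.prod isClosed_Icc) isClosed_Iic)
    Set.inter_subset_left

theorem overbatch (hP : P.Valid M) (hK : 1 ≤ K) (hM : 0 ≤ M) (hε : 0 < ε) (hh : 0 < h)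
    (hγ : 2 < γ) (hB₁ : 4 * P.kappa * P.d < P.overbatchB ε h)
    (hS : P.smoothingRemainder (P.overbatchN ε) (P.overbatchB ε h) h ≤ smoothingLevel K M * ε) :
    (∃ D, IsOptimalDesign γ {D ∈ feasibleDesigns K P ε h 1 | 4 * P.kappa * P.d < D.B} D) ∧
      ∀ D, IsOptimalDesign γ {D ∈ feasibleDesigns K P ε h 1 | 4 * P.kappa * P.d < D.B} D →
        D.δ = 1 ∧
        SameOrder (1 / (8 * K) ^ 2) (32 * K ^ 3) D.N (P.overbatchN ε) ∧
        SameOrder (1 / (8 * K) ^ 2) (32 * K ^ 3) D.B (P.overbatchB ε h) ∧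
        SameOrder (1 / (8 * K) ^ 2) (32 * K ^ 3) (D.wallClock γ) (P.overbatchTime ε h) ∧
        (∀ D' ∈ feasibleDesigns K P ε h 1, D'.B ≤ 4 * P.kappa * P.d →
          D.wallClock γ ≤ upperConst K γ * P.baseFidelity ε h ^ (γ - 2) * D'.wallClock γ) := by
  have hγ0 : 0 < γ := by linarith
  have hK0 : 0 < K := by linarith
  have hκ := hP.kappa_pos; have hd := hP.d_pos
  have hκB₁ := hP.kappa_mul_d_lt hB₁
  have hB₁0 : 0 < P.overbatchB ε h := lt_trans (by positivity) hκB₁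
  have hN₁0 := overbatchN_pos hP hε
  have hbase := baseFidelity_pos hP hε hh
  have hRt := hP.Rt_nonneg
  have hT₁ := overbatchTime_eq hP hε hh
  have hK2 : 1 ≤ K ^ 2 := one_le_pow₀ hK
  have hK3 : 1 ≤ K ^ 3 := one_le_pow₀ hK
  -- a feasible design of the asserted order: the factor `8 K²` in `B₀` makes the fidelity `1` equal to
  -- `v = (8 K²)^(-1/2)` natural units, which `2 K` iterations can afford
  set B₀ := 8 * K ^ 2 * P.overbatchB ε h with hB₀
  have hB₁₀ : P.overbatchB ε h ≤ B₀ := le_mul_of_one_le_left hB₁0.le (by nlinarith)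
  have hκB₀ := hκB₁.trans_le hB₁₀
  have hB₀0 : 0 < B₀ := hB₁0.trans_le hB₁₀
  have hx₁ := iterUnit_eq_overbatchN (ε := ε) hP hB₁0 hκB₁.le
  have hx₀ := iterUnit_eq_overbatchN (ε := ε) hP hB₀0 hκB₀.le
  obtain ⟨hσ, hρ⟩ := smoothing_negligible hP hK hM hε hh hB₁0 (N := P.overbatchN ε)
    (by rw [hx₁]; linarith) hS
  set D₀ : Design := ⟨2 * K * P.overbatchN ε, B₀, 1⟩ with hD₀
  have hD₀mem : D₀ ∈ feasibleDesigns K P ε h 1 := by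
    rw [mem_feasibleDesigns_iff hP hε hh hB₀0]
    have hf := fidelityUnit_pos (B := B₀) hP hε hh
    have hred : P.reduce ε h D₀ = (2 * K, 1 / P.fidelityUnit ε h B₀) := by
      simp only [reduce, D₀, hx₀, mul_div_cancel_right₀ _ hN₁0.ne']
    rw [hred]
    refine mem_reducedFeasible_two_mul hK (le_trans ?_ hσ) hρ (by positivity) ?_ (le_of_eq ?_)
    · change P.smoothingRate h B₀ * P.iterUnit ε B₀ / ε ≤ _
      rw [hx₀, hx₁]
      gcongr
      exact smoothingRate_anti hP hκB₁ hB₁₀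
    · change ((P.fidelityUnit ε h B₀ * (1 / P.fidelityUnit ε h B₀) : ℝ) : EReal) ≤ 1
      rw [mul_one_div_cancel hf.ne']; rfl
    · rw [div_pow, one_pow, fidelityUnit, mul_pow, Real.sq_sqrt batchLoad_pos.le,
        batchLoad_eq hP hκB₀.le, hB₀, overbatchB_eq hP hε hh]
      field_simp
  have hD₀T : D₀.wallClock γ = 16 * K ^ 3 * P.overbatchTime ε h := by
    simp only [Design.wallClock, D₀, Real.one_rpow, hT₁, hB₀]; ring
  have hfull : ∀ N B : ℝ, (⟨N, B, 1⟩ : Design).wallClock γ = B * N := fun N B => by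
    simp [Design.wallClock]
  -- trading fidelity for batch size at constant error pays, since `δ^(-2) ≤ δ^(-γ)`
  have htrade : ∀ D : Design, 0 < D.N → 0 < D.B → 0 < D.δ →
      (D.δ ≤ 1 → D.B / D.δ ^ 2 * D.N ≤ D.wallClock γ) ∧
      (D.δ < 1 → D.B / D.δ ^ 2 * D.N < D.wallClock γ) := by
    intro D hN hB hδ
    have hrw : D.B / D.δ ^ 2 * D.N = D.B * D.N * D.δ ^ (-2 : ℝ) := by
      rw [Real.rpow_neg hδ.le]; norm_cast; field_simp
    rw [hrw, Design.wallClock]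
    refine ⟨fun h1 => ?_, fun h1 => ?_⟩
    · have := Real.rpow_le_rpow_of_exponent_ge hδ h1 (by linarith : -γ ≤ -2)
      gcongr
    · have := Real.rpow_lt_rpow_of_exponent_gt hδ h1 (by linarith : -γ < -2)
      gcongr
  constructor
  · -- at full fidelity the error bound is continuous and the time is coercive in `(N, B)`
    obtain ⟨q, hq, hmin⟩ := exists_forall_le_of_sublevel
      (s := {q : ℝ × ℝ | (P.overbatchN ε ≤ q.1 ∧ P.overbatchB ε h ≤ q.2) ∧
        K * P.errorBound q.1 q.2 1 h ≤ ε})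
      (C := Set.Icc (P.overbatchN ε) (16 * K ^ 3 * P.overbatchN ε)
        ×ˢ Set.Icc (P.overbatchB ε h) (16 * K ^ 3 * P.overbatchB ε h))
      (f := fun q => q.2 * q.1) (x₀ := (2 * K * P.overbatchN ε, B₀))
      ⟨⟨le_mul_of_one_le_left hN₁0.le (by linarith), hB₁₀⟩, hD₀mem.2.2.2.2⟩ (by
        convert isCompact_fullFidelity_inter (K := K) (ε := ε) (h := h) hP hN₁0 hκB₁ _ _ using 1
        ext q
        simp only [Set.mem_inter_iff, Set.mem_ofPred_eq, Set.mem_prod, Set.mem_Icc]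
        tauto)
      (by fun_prop) (by
        rintro ⟨N, B⟩ ⟨⟨h1, h2⟩, -⟩ hle
        have hle : B * N ≤ 16 * K ^ 3 * (P.overbatchB ε h * P.overbatchN ε) := by
          refine hle.trans (le_of_eq ?_)
          simp only [hB₀]; ring
        dsimp only at h1 h2
        refine ⟨⟨h1, ?_⟩, h2, ?_⟩
        · have : P.overbatchB ε h * N ≤ B * N := by gcongr; linarith
          exact le_of_mul_le_mul_left (by linarith) hB₁0
        · have : B * P.overbatchN ε ≤ B * N := by gcongr; linarith
          exact le_of_mul_le_mul_right (by linarith) hN₁0)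
    obtain ⟨⟨hq1, hq2⟩, hqE⟩ := hq
    refine ⟨⟨q.1, q.2, 1⟩, ⟨⟨hN₁0.trans_le hq1, hB₁0.trans_le hq2, one_pos, le_rfl, hqE⟩,
      hB₁.trans_le hq2⟩, fun D ⟨hD, hDB⟩ => ?_⟩
    obtain ⟨hD', hDB'⟩ := feasibleDesigns.full_fidelity hP hK hh hD hDB
    have hlow := feasibleDesigns.overbatch_le hP hK hε hh hD' hDB' rfl
    have hδ1 : D.δ ≤ 1 := by exact_mod_cast hD.2.2.2.1
    rw [hfull]
    exact (hmin (D.N, D.B / D.δ ^ 2) ⟨hlow, hD'.2.2.2.2⟩).trans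
      ((htrade D hD.1 hD.2.1 hD.2.2.1).1 hδ1)
  · rintro D ⟨⟨hD, hDB⟩, hmin⟩
    have hN0 := hD.1
    have hB0 := hD.2.1
    have hδ1 : D.δ ≤ 1 := by exact_mod_cast hD.2.2.2.1
    have hδ : D.δ = 1 := by
      refine hδ1.eq_of_not_lt fun hlt => ?_
      have h1 := hmin _ (feasibleDesigns.full_fidelity hP hK hh hD hDB)
      rw [hfull] at h1
      exact absurd ((htrade D hD.1 hD.2.1 hD.2.2.1).2 hlt) (not_lt.2 h1)
    obtain ⟨hNl, hBl⟩ := feasibleDesigns.overbatch_le hP hK hε hh hD hDB hδ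
    have hT : D.wallClock γ = D.B * D.N := by rw [Design.wallClock, hδ, Real.one_rpow, mul_one]
    have hTu : D.wallClock γ ≤ 16 * K ^ 3 * P.overbatchTime ε h := by
      rw [← hD₀T]; exact hmin _ ⟨hD₀mem, hB₁.trans_le hB₁₀⟩
    have hT₁0 : 0 < P.overbatchTime ε h := by rw [hT₁]; positivity
    have hc : 1 / (8 * K) ^ 2 ≤ 1 := by
      rw [div_le_one (by positivity)]; nlinarith
    refine ⟨hδ, ⟨?_, ?_⟩, ⟨?_, ?_⟩, ⟨?_, ?_⟩, fun D' hD' hB' => ?_⟩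
    · exact (mul_le_of_le_one_left hN₁0.le hc).trans hNl
    · have h1 : P.overbatchB ε h * D.N ≤ D.B * D.N := by gcongr
      rw [hT, hT₁] at hTu
      have h2 : D.N ≤ 16 * K ^ 3 * P.overbatchN ε :=
        le_of_mul_le_mul_left (by linarith) hB₁0
      refine h2.trans ?_
      gcongr; norm_num
    · exact (mul_le_of_le_one_left hB₁0.le hc).trans hBl
    · have h1 : D.B * P.overbatchN ε ≤ D.B * D.N := by gcongr
      rw [hT, hT₁] at hTu
      have h2 : D.B ≤ 16 * K ^ 3 * P.overbatchB ε h :=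
        le_of_mul_le_mul_right (by linarith) hN₁0
      refine h2.trans ?_
      gcongr; norm_num
    · refine (mul_le_of_le_one_left hT₁0.le hc).trans ?_
      rw [hT₁, hT]
      gcongr
    · refine hTu.trans ?_
      gcongr; norm_num
    · have hlow := (feasibleDesigns.bounds hP hK hγ0 hε hh hD').2.2
      rw [timeUnit_eq_smallBatchTime_mul hP hε hh] at hlow
      have hT₀ : 0 < P.smallBatchTime γ ε h := by
        have := queryUnit_pos hP hε
        rw [← queryUnit_mul_rpow hP hε hh]; positivity
      have hpow := le_batchLoad_rpow hP hγ0 hB'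
      have h2 : (2 : ℝ) ^ γ * 2 ^ (-γ) = 1 := by
        rw [← Real.rpow_add (by norm_num), add_neg_cancel, Real.rpow_zero]
      have hu := (upperConst_bounds hK hγ0).2
      calc D.wallClock γ ≤ 16 * K ^ 3 * P.overbatchTime ε h := hTu
        _ = 16 * K ^ 3 * 2 ^ γ * P.baseFidelity ε h ^ (γ - 2)
              * (P.smallBatchTime γ ε h * 2 ^ (-γ)) := by
            rw [overbatchTime_eq_mul_smallBatchTime (γ := γ) hP hε hh]
            linear_combination (-16 * K ^ 3 * P.baseFidelity ε h ^ (γ - 2)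
              * P.smallBatchTime γ ε h) * h2
        _ ≤ upperConst K γ * P.baseFidelity ε h ^ (γ - 2) * D'.wallClock γ := by
            have h3 : P.smallBatchTime γ ε h * 2 ^ (-γ) ≤ D'.wallClock γ :=
              le_trans (by gcongr) hlow
            have h4 : 0 ≤ upperConst K γ := le_trans (by positivity) hu
            gcongr

end AccSetting

end

theorem mainTheorem8 (K M : ℝ) (hK : 1 ≤ K) (hM : 0 ≤ M) :
    -- `c₀, c₁, c₂` depend only on `K, M`, and `a γ, b γ` only on `K, M, γ`
    ∃ c₀ c₁ c₂ : ℝ, 0 < c₀ ∧ 0 < c₁ ∧ 0 < c₂ ∧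
    ∃ a b : ℝ → ℝ, (∀ γ : ℝ, 0 < γ → 0 < a γ ∧ 0 < b γ) ∧
    ∀ (P : AccSetting), P.Valid M → ∀ (γ ε h : ℝ), 0 < γ → 0 < ε → 0 < h →
      -- small-batch regime
      (∀ (Δ : EReal) (B : ℝ), 0 < B → B ≤ 4 * P.kappa * P.d →
        (P.smallBatchFidelity γ ε h : EReal) ≤ Δ →
        P.smoothingRemainder (P.smallBatchQ γ ε / B) B h ≤ c₀ * ε →
        (∃ D, IsOptimalDesign γ {D ∈ feasibleDesigns K P ε h Δ | D.B = B} D) ∧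
        ∀ D, IsOptimalDesign γ {D ∈ feasibleDesigns K P ε h Δ | D.B = B} D →
          SameOrder c₁ c₂ D.Q (P.smallBatchQ γ ε) ∧
          SameOrder c₁ c₂ D.δ (P.smallBatchFidelity γ ε h) ∧
          SameOrder (a γ) (b γ) (D.wallClock γ) (P.smallBatchTime γ ε h) ∧
          -- for `γ ≤ 2`, overbatching is not beneficial at leading order
          (γ ≤ 2 → ∀ D' ∈ feasibleDesigns K P ε h Δ, 4 * P.kappa * P.d < D'.B →
            D.wallClock γ ≤ b γ * D'.wallClock γ)) ∧
      -- large-batch regime, fixed `B`, interior fidelity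
      (∀ (Δ : EReal) (B : ℝ), 4 * P.kappa * P.d < B →
        (P.largeBatchFidelity γ ε h B : EReal) ≤ Δ →
        P.smoothingRemainder (P.largeBatchN γ ε) B h ≤ c₀ * ε →
        (∃ D, IsOptimalDesign γ {D ∈ feasibleDesigns K P ε h Δ | D.B = B} D) ∧
        ∀ D, IsOptimalDesign γ {D ∈ feasibleDesigns K P ε h Δ | D.B = B} D →
          SameOrder (a γ) (b γ) (D.δ ^ 2)
            (ε * B * P.L * h ^ 2 / (D.N * P.kappa * (P.d : ℝ) ^ 2)) ∧
          SameOrder (a γ) (b γ) (D.wallClock γ)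
            (P.largeBatchTimeFactor γ ε h * B ^ (1 - γ / 2))) ∧
      -- overbatching for `γ > 2`: `N`, `B > 4κd` and `δ ∈ (0, 1]` are optimized jointly
      (2 < γ → 4 * P.kappa * P.d < P.overbatchB ε h →
        P.smoothingRemainder (P.overbatchN ε) (P.overbatchB ε h) h ≤ c₀ * ε →
        (∃ D, IsOptimalDesign γ
          {D ∈ feasibleDesigns K P ε h 1 | 4 * P.kappa * P.d < D.B} D) ∧
        ∀ D, IsOptimalDesign γ
            {D ∈ feasibleDesigns K P ε h 1 | 4 * P.kappa * P.d < D.B} D →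
          D.δ = 1 ∧
          SameOrder c₁ c₂ D.N (P.overbatchN ε) ∧
          SameOrder c₁ c₂ D.B (P.overbatchB ε h) ∧
          SameOrder c₁ c₂ (D.wallClock γ) (P.overbatchTime ε h) ∧
          -- the gain over every small-batch design
          (∀ D' ∈ feasibleDesigns K P ε h 1, D'.B ≤ 4 * P.kappa * P.d →
            D.wallClock γ ≤ b γ * P.baseFidelity ε h ^ (γ - 2) * D'.wallClock γ)) := by
  have hK8 : 0 < 8 * K := by linarith
  refine ⟨AccSetting.smoothingLevel K M, 1 / (8 * K) ^ 2, 32 * K ^ 3, ?_, by positivity,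
    by positivity, AccSetting.lowerConst K, AccSetting.upperConst K, fun γ hγ =>
      ⟨AccSetting.lowerConst_pos hK hγ, one_pos.trans_le (AccSetting.one_le_upperConst hK hγ)⟩, ?_⟩
  · unfold AccSetting.smoothingLevel; positivity
  intro P hP γ ε h hγ hε hh
  exact ⟨fun Δ B hB hB4 hΔ hS => AccSetting.small_batch hP hK hM hγ hε hh hB hB4 hΔ hS,
    fun Δ B hB4 hΔ hS => AccSetting.large_batch hP hK hM hγ hε hh hB4 hΔ hS,
    fun hγ2 hB₁ hS => AccSetting.overbatch hP hK hM hε hh hγ2 hB₁ hS⟩
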